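/- Let $\alpha,\beta,\gamma>0$ be real, let $A,B$ be real constants with $A\ge 0$, $A+B\ge 0$ and $(A,B)\ne(0,0)$, and let $\theta$ be the Heaviside function ($\theta(x)=1$ for $x>0$ and $\theta(x)=0$ otherwise). For $x,t\in[0,1]$ put $$w(x,t)=x^{\alpha}(1-x)^{\beta}|x-t|^{\gamma}\bigl(A+B\,\theta(x-t)\bigr),$$ and for an integer $n\ge 0$ let $$D_n(t)=\det\left(\int_0^1 x^{i+j}w(x,t)\,dx\right)_{i,j=0}^{n-1}\quad(D_0=1),\qquad H_n(t)=t(t-1)\frac{d}{dt}\ln D_n(t).$$ Then for every $t\in(0,1)$ we have $D_n(t)>0$, the function $D_n$ is differentiable at $t$ and $H_n$ is twice differentiable at $t$, and $H_n$ satisfies $$\begin{aligned} &t^2(t-1)^2 (H_n'')^2+4t (t-1) (H_n')^3\\ &-\Big\{4 (2 t-1) H_n+\left[4 n^2+4 n (\alpha +\beta +\gamma )+(\alpha +\beta )^2\right]t^2\\ &\qquad-2\left[2 n^2+2 n (\alpha +\beta +\gamma)+\alpha(\alpha+\gamma)+\beta(\alpha-\gamma)\right]t+(\alpha+\gamma)^2\Big\}(H_n')^2\\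 &+2\Big\{2H_n^2+\left[\left(4 n^2+4 n (\alpha +\beta +\gamma )+(\alpha +\beta )^2\right)t-2 n^2-2 n (\alpha +\beta +\gamma )-\alpha(\alpha+\gamma)-\beta(\alpha-\gamma)\right]H_n\\ &\qquad-n\gamma(n+\alpha +\beta +\gamma)\left[(\alpha-\beta) t-\alpha-\gamma\right]\Big\}H_n'\\ &- \left[4 n^2+4 n (\alpha +\beta +\gamma )+(\alpha +\beta )^2\right]H_n^2+2 n\gamma(\alpha -\beta )(n+\alpha +\beta +\gamma) H_n- n^2\gamma^2(n+\alpha +\beta +\gamma)^2=0 \end{aligned}$$ at $t$. -/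

import Mathlib

noncomputable section

namespace DegenerateJacobi

/-- The Heaviside step function: `1` for `x > 0` and `0` otherwise. -/
def heaviside (x : ℝ) : ℝ := if 0 < x then 1 else 0

/-- The weight `x^α (1-x)^β |x-t|^γ (A + B θ(x-t))`, to be used for `x, t ∈ [0,1]`. -/
def weight (α β γ A B x t : ℝ) : ℝ :=
  x ^ α * (1 - x) ^ β * |x - t| ^ γ * (A + B * heaviside (x - t))

/-- The moment `∫₀¹ x^k w(x,t) dx`. -/
def moment (α β γ A B : ℝ) (k : ℕ) (t : ℝ) : ℝ :=
  ∫ x in (0 : ℝ)..1, x ^ k * weight α β γ A B x t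

/-- The Hankel determinant `D_n(t) = det (∫₀¹ x^(i+j) w(x,t) dx)`, `0 ≤ i, j ≤ n - 1`. -/
def hankelDet (α β γ A B : ℝ) (n : ℕ) (t : ℝ) : ℝ :=
  Matrix.det (Matrix.of fun i j : Fin n => moment α β γ A B ((i : ℕ) + (j : ℕ)) t)

/-- `H_n(t) = t (t - 1) d/dt ln D_n(t)`. -/
def H (α β γ A B : ℝ) (n : ℕ) (t : ℝ) : ℝ :=
  t * (t - 1) * deriv (fun s => Real.log (hankelDet α β γ A B n s)) t

/-- The left-hand side of the second-order differential equation for `H_n` at the point `t`, with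
`h`, `h₁`, `h₂` in the places of `H_n`, `H_n'`, `H_n''`. -/
def odeLhs (α β γ n t h h₁ h₂ : ℝ) : ℝ :=
  t ^ 2 * (t - 1) ^ 2 * h₂ ^ 2 + 4 * t * (t - 1) * h₁ ^ 3
   - (4 * (2 * t - 1) * h
       + (4 * n ^ 2 + 4 * n * (α + β + γ) + (α + β) ^ 2) * t ^ 2
       - 2 * (2 * n ^ 2 + 2 * n * (α + β + γ) + α * (α + γ) + β * (α - γ)) * t
       + (α + γ) ^ 2) * h₁ ^ 2
   + 2 * (2 * h ^ 2
       + ((4 * n ^ 2 + 4 * n * (α + β + γ) + (α + β) ^ 2) * t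
           - 2 * n ^ 2 - 2 * n * (α + β + γ) - α * (α + γ) - β * (α - γ)) * h
       - n * γ * (n + α + β + γ) * ((α - β) * t - α - γ)) * h₁
   - (4 * n ^ 2 + 4 * n * (α + β + γ) + (α + β) ^ 2) * h ^ 2
   + 2 * n * γ * (α - β) * (n + α + β + γ) * h
   - n ^ 2 * γ ^ 2 * (n + α + β + γ) ^ 2

end DegenerateJacobi

end

/-! ### The factor `|u| ^ γ (A + B θ(u))` and integrability of the weight. -/

noncomputable section

namespace DegenerateJacobi

open MeasureTheory Set Filter Topology

/-! This is the isomonodromy derivation of a Painlevé VI σ-form. On either side of `t` the weight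
has logarithmic derivative `α/x + β/(x-1) + γ/(x-t)`, whatever `A` and `B` are; these enter only
through positivity. Write `L` for integration against the weight, `L_c f = L (f/(x-c))` for `c = 0,
1, t`, and `n = m + 1`. Let `P`, `R` be the orthogonal polynomials of degrees `n`, `n - 1`, and `K
s` the reproducing kernel.

Integration by parts (the Pearson identity) leads to 2×2 residue matrices at `0, 1, t`, built from
`x = R(c) L_c P`, `y = P(c) L_c P`, `z = R(c) L_c R`. The Casoratian `R(c) L_c P - P(c) L_c R = 1`
gives `y z = x (x - 1)`, and the residues sum to a diagonal matrix (`sum_residue_PR` and its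
companions). Moving `t` gives the Schlesinger equations (`schlesinger`).

Jacobi's formula and a trace identity yield `(log D_n)' = -γ L_t (K t)`. By Christoffel–Darboux this
makes `H_n` a quadratic expression in the residues (`apply_K_self`). Along the flow `H_n'` is again
quadratic and `t (t - 1) H_n''` is a multiple of `z₀ y₁ - y₀ z₁`; the determinant constraints
eliminate every `y` and `z`, and the equation becomes a polynomial identity (`ode_of_residues`). -/

/-- The factor `|u|^γ (A + B θ(u))` of the weight, with `u = x - t`. -/
def jump (γ A B u : ℝ) : ℝ := |u| ^ γ * (A + B * heaviside u)

/-- The integral of `x^a (1-x)^b |x-t|^γ (A + B θ(x-t))` over `[0,1]`. -/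
def jumpIntegral (γ A B a b t : ℝ) : ℝ :=
  ∫ x in (0 : ℝ)..1, x ^ a * (1 - x) ^ b * jump γ A B (x - t)

/-- The integral of `x^a (1-x)^b |x-t|^γ (A + B θ(x-t)) / (x - t)` over `[0,1]`. -/
def jumpDivIntegral (γ A B a b t : ℝ) : ℝ :=
  ∫ x in (0 : ℝ)..1, x ^ a * (1 - x) ^ b * (jump γ A B (x - t) / (x - t))

section Jump

variable {γ A B : ℝ}

/-- In this form the step of `θ` at `0` is visibly harmless: both powers are continuous. -/
lemma jump_eq_add (hγ : 0 < γ) (u : ℝ) :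
    jump γ A B u = A * |u| ^ γ + B * (max u 0) ^ γ := by
  unfold jump heaviside
  split_ifs with h
  · rw [max_eq_left h.le, abs_of_pos h]; ring
  · rw [max_eq_right (not_lt.mp h), Real.zero_rpow hγ.ne']; ring

lemma jump_zero (hγ : 0 < γ) : jump γ A B 0 = 0 := by
  simp [jump, Real.zero_rpow hγ.ne']

lemma continuous_jump (hγ : 0 < γ) : Continuous (jump γ A B) := by
  rw [funext (jump_eq_add hγ)]
  have h1 : Continuous fun u : ℝ => |u| ^ γ :=
    continuous_abs.rpow_const fun _ => Or.inr hγ.le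
  have h2 : Continuous fun u : ℝ => (max u 0) ^ γ :=
    (continuous_id.max continuous_const).rpow_const fun _ => Or.inr hγ.le
  fun_prop

/-- At `u = 0` the quotient has the default value `0`, which is consistent because the jump factor
vanishes there. -/
lemma mul_jump_div_self (hγ : 0 < γ) (u : ℝ) : u * (jump γ A B u / u) = jump γ A B u := by
  rcases eq_or_ne u 0 with rfl | hu
  · simp [jump_zero hγ]
  · field_simp

/-- On each half-line the factor is a constant times `|u| ^ γ`, so its logarithmic derivative is `γ
/ u` independently of `A` and `B`. -/
lemma hasDerivAt_jump (hγ : 0 < γ) {u : ℝ} (hu : u ≠ 0) :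
    HasDerivAt (jump γ A B) (γ * (jump γ A B u / u)) u := by
  rcases lt_or_gt_of_ne hu with h | h
  · have h1 : HasDerivAt (fun v : ℝ => A * (-v) ^ γ) (A * (-1 * γ * (-u) ^ (γ - 1))) u :=
      (((hasDerivAt_id u).neg).rpow_const (p := γ) (Or.inl (by simpa using hu))).const_mul A
    have h2 : jump γ A B =ᶠ[𝓝 u] fun v => A * (-v) ^ γ := by
      filter_upwards [Iio_mem_nhds h] with v hv
      have hv' : v < 0 := hv
      simp [jump, heaviside, abs_of_neg hv', not_lt.mpr hv'.le, mul_comm]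
    refine (h1.congr_of_eventuallyEq h2).congr_deriv ?_
    rw [h2.eq_of_nhds, Real.rpow_sub_one (by linarith)]
    field_simp
  · have h1 : HasDerivAt (fun v : ℝ => (A + B) * v ^ γ) ((A + B) * (1 * γ * u ^ (γ - 1))) u :=
      ((hasDerivAt_id u).rpow_const (p := γ) (Or.inl hu)).const_mul _
    have h2 : jump γ A B =ᶠ[𝓝 u] fun v => (A + B) * v ^ γ := by
      filter_upwards [Ioi_mem_nhds h] with v hv
      have hv' : 0 < v := hv
      simp [jump, heaviside, abs_of_pos hv', hv', mul_comm]
    refine (h1.congr_of_eventuallyEq h2).congr_deriv ?_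
    rw [h2.eq_of_nhds, Real.rpow_sub_one h.ne']
    field_simp

lemma intervalIntegrable_abs_rpow {r : ℝ} (hr : -1 < r) (a b : ℝ) :
    IntervalIntegrable (fun u : ℝ => |u| ^ r) volume a b := by
  have key : ∀ c : ℝ, 0 ≤ c → IntervalIntegrable (fun u : ℝ => |u| ^ r) volume 0 c := fun c hc =>
    (intervalIntegral.intervalIntegrable_rpow' hr).congr fun u hu => by
      rw [uIoc_of_le hc] at hu
      simp [abs_of_pos hu.1]
  have key' : ∀ c : ℝ, IntervalIntegrable (fun u : ℝ => |u| ^ r) volume 0 c := fun c => by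
    rcases le_total 0 c with hc | hc
    · exact key c hc
    · rw [IntervalIntegrable.iff_comp_neg]
      simpa using key (-c) (by linarith)
  exact (key' a).symm.trans (key' b)

lemma measurable_jump (hγ : 0 < γ) : Measurable (jump γ A B) := (continuous_jump hγ).measurable

lemma intervalIntegrable_jump_div (hγ : 0 < γ) (a b : ℝ) :
    IntervalIntegrable (fun u => jump γ A B u / u) volume a b := by
  refine ((intervalIntegrable_abs_rpow (r := γ - 1) (by linarith) a b).const_mul
    (|A| + |B|)).mono_fun ?_ (Eventually.of_forall fun u => ?_)
  · exact ((measurable_jump hγ).div measurable_id).aestronglyMeasurable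
  · rcases eq_or_ne u 0 with rfl | hu
    · simp only [div_zero, norm_zero]; positivity
    · have h1 : |A + B * heaviside u| ≤ |A| + |B| := by
        unfold heaviside
        split_ifs
        · simpa using abs_add_le A B
        · simp
      have h2 : 0 < |u| := abs_pos.mpr hu
      simp only [jump, Real.norm_eq_abs, abs_mul, abs_div]
      rw [Real.rpow_sub_one h2.ne', abs_div, abs_abs, abs_of_nonneg (add_nonneg (abs_nonneg A) (abs_nonneg B))]
      rw [mul_div_assoc', mul_comm]
      gcongr

lemma integral_jump_div (hγ : 0 < γ) (a b : ℝ) :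
    γ * ∫ u in a..b, jump γ A B u / u = jump γ A B b - jump γ A B a := by
  rw [← intervalIntegral.integral_const_mul]
  exact integral_eq_of_hasDerivAt_off_countable _ _ (countable_singleton 0)
    (continuous_jump hγ).continuousOn
    (fun x hx => hasDerivAt_jump hγ hx.2) ((intervalIntegrable_jump_div hγ a b).const_mul γ)

end Jump

section Integrability

variable {γ A B a b t : ℝ}

/-- The endpoints are separated at `1/2` and exchanged by `x ↦ 1 - x`. Negative exponents matter
because `α - 1` and `β - 1` occur later. -/
lemma intervalIntegrable_rpow_mul_one_sub_rpow (ha : -1 < a) (hb : -1 < b) :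
    IntervalIntegrable (fun x : ℝ => x ^ a * (1 - x) ^ b) volume 0 1 := by
  have key : ∀ {a b : ℝ}, -1 < a →
      IntervalIntegrable (fun x : ℝ => x ^ a * (1 - x) ^ b) volume 0 (1 / 2) := fun {a b} ha => by
    refine (intervalIntegral.intervalIntegrable_rpow' ha).mul_continuousOn ?_
    refine (continuousOn_const.sub continuousOn_id).rpow_const fun x hx => Or.inl ?_
    rw [uIcc_of_le (by norm_num)] at hx
    have := hx.2
    intro h
    have h' : 1 - x = 0 := h
    linarith
  refine (key ha).trans ?_
  have h := (key (b := a) hb).comp_sub_left 1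
  norm_num at h
  refine h.symm.congr fun x _ => ?_
  simp [mul_comm]

lemma continuousOn_jump_div (hγ : 0 < γ) {s : Set ℝ} (hs : t ∉ s) :
    ContinuousOn (fun x => jump γ A B (x - t) / (x - t)) s := by
  refine ContinuousOn.div ?_ (by fun_prop) fun x hx h => hs ?_
  · exact ((continuous_jump hγ).comp (by fun_prop : Continuous fun x : ℝ => x - t)).continuousOn
  · rwa [← sub_eq_zero.mp h]

lemma intervalIntegrable_mul_jump (hγ : 0 < γ) (ha : -1 < a) (hb : -1 < b) (t : ℝ) :
    IntervalIntegrable (fun x => x ^ a * (1 - x) ^ b * jump γ A B (x - t)) volume 0 1 :=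
  (intervalIntegrable_rpow_mul_one_sub_rpow ha hb).mul_continuousOn
    ((continuous_jump hγ).comp (by fun_prop : Continuous fun x : ℝ => x - t)).continuousOn

/-- Cutting at `t / 2` and `(1 + t) / 2` leaves one of the singular points `0`, `t`, `1` in each
piece. -/
lemma intervalIntegrable_mul_jump_div (hγ : 0 < γ) (ha : -1 < a) (hb : -1 < b)
    (ht0 : 0 < t) (ht1 : t < 1) :
    IntervalIntegrable (fun x => x ^ a * (1 - x) ^ b * (jump γ A B (x - t) / (x - t)))
      volume 0 1 := by
  have h := intervalIntegrable_rpow_mul_one_sub_rpow ha hb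
  have h01 : IntervalIntegrable (fun x => x ^ a * (1 - x) ^ b * (jump γ A B (x - t) / (x - t)))
      volume 0 (t / 2) := by
    refine (h.mono_set ?_).mul_continuousOn (continuousOn_jump_div hγ ?_)
    · rw [uIcc_of_le (by linarith), uIcc_of_le zero_le_one]
      exact Icc_subset_Icc_right (by linarith)
    · rw [uIcc_of_le (by linarith)]
      exact fun h => by linarith [h.2]
  have h12 : IntervalIntegrable (fun x => x ^ a * (1 - x) ^ b * (jump γ A B (x - t) / (x - t)))
      volume (t / 2) ((1 + t) / 2) := by
    have h' := (intervalIntegrable_jump_div (A := A) (B := B) hγ (t / 2 - t)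
      ((1 + t) / 2 - t)).comp_sub_right t
    simp only [sub_add_cancel] at h'
    refine h'.continuousOn_mul ?_
    rw [uIcc_of_le (by linarith)]
    refine ContinuousOn.mul ?_ ?_
    · exact continuousOn_id.rpow_const fun x hx => Or.inl (by
        have := hx.1; intro h; simp only [id] at h; linarith)
    · exact (continuousOn_const.sub continuousOn_id).rpow_const fun x hx => Or.inl (by
        have := hx.2; intro h; have h' : 1 - x = 0 := h; linarith)
  have h23 : IntervalIntegrable (fun x => x ^ a * (1 - x) ^ b * (jump γ A B (x - t) / (x - t)))
      volume ((1 + t) / 2) 1 := by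
    refine (h.mono_set ?_).mul_continuousOn (continuousOn_jump_div hγ ?_)
    · rw [uIcc_of_le (by linarith), uIcc_of_le zero_le_one]
      exact Icc_subset_Icc_left (by linarith)
    · rw [uIcc_of_le (by linarith)]
      exact fun h => by linarith [h.1]
  exact (h01.trans h12).trans h23

end Integrability

end DegenerateJacobi
end

/-! ### Integration by parts and differentiation of the moments in `t`. -/

noncomputable section

namespace DegenerateJacobi

open MeasureTheory Set Filter Topology

section Calculus

variable {γ A B a b t : ℝ}

lemma continuousAt_jumpIntegral (hγ : 0 < γ) (ha : -1 < a) (hb : -1 < b)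
    (ht0 : 0 < t) (ht1 : t < 1) : ContinuousAt (jumpIntegral γ A B a b) t := by
  obtain ⟨C, hC⟩ := (isCompact_Icc (a := (-1 : ℝ)) (b := 1)).exists_bound_of_continuousOn
    (continuous_jump (A := A) (B := B) hγ).continuousOn
  refine intervalIntegral.continuousAt_of_dominated_interval
    (bound := fun x => ‖x ^ a * (1 - x) ^ b‖ * C) ?_ ?_ ?_ ?_
  · refine Eventually.of_forall fun s => ?_
    have := (intervalIntegrable_mul_jump (A := A) (B := B) hγ ha hb s).aestronglyMeasurable
    rwa [uIoc_of_le zero_le_one]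
  · filter_upwards [Ioo_mem_nhds ht0 ht1] with s hs
    refine Eventually.of_forall fun x hx => ?_
    rw [uIoc_of_le zero_le_one] at hx
    rw [norm_mul]
    gcongr
    exact hC _ ⟨by linarith [hx.1, hs.2], by linarith [hx.2, hs.1]⟩
  · exact (intervalIntegrable_rpow_mul_one_sub_rpow ha hb).norm.mul_const C
  · refine Eventually.of_forall fun x _ => ?_
    have h : Continuous fun s => jump γ A B (x - s) :=
      (continuous_jump hγ).comp (by fun_prop)
    exact (continuous_const.mul h).continuousAt

/-- Integration by parts: the integral of `d/dx (x^a (1-x)^b |x-t|^γ (A + B θ(x-t)))` vanishes. -/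
lemma jump_integration_by_parts (hγ : 0 < γ) (ha : 0 < a) (hb : 0 < b)
    (ht0 : 0 < t) (ht1 : t < 1) :
    a * jumpIntegral γ A B (a - 1) b t - b * jumpIntegral γ A B a (b - 1) t
      + γ * jumpDivIntegral γ A B a b t = 0 := by
  have i1 := (intervalIntegrable_mul_jump (A := A) (B := B) hγ (by linarith : -1 < a - 1)
    (by linarith : -1 < b) t).const_mul a
  have i2 := (intervalIntegrable_mul_jump (A := A) (B := B) hγ (by linarith : -1 < a)
    (by linarith : -1 < b - 1) t).const_mul b
  have i3 := (intervalIntegrable_mul_jump_div (A := A) (B := B) hγ (by linarith : -1 < a)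
    (by linarith : -1 < b) ht0 ht1).const_mul γ
  have key := integral_eq_of_hasDerivAt_off_countable
    (fun x => x ^ a * (1 - x) ^ b * jump γ A B (x - t))
    (fun x => a * (x ^ (a - 1) * (1 - x) ^ b * jump γ A B (x - t))
      - b * (x ^ a * (1 - x) ^ (b - 1) * jump γ A B (x - t))
      + γ * (x ^ a * (1 - x) ^ b * (jump γ A B (x - t) / (x - t)))) (a := 0) (b := 1)
    -- Differentiability may fail at `x = t`; continuity there suffices for the fundamental theorem.
    (countable_singleton t) ?_ ?_ ((i1.sub i2).add i3)
  · rw [intervalIntegral.integral_add (i1.sub i2) i3, intervalIntegral.integral_sub i1 i2] at key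
    simp only [intervalIntegral.integral_const_mul] at key
    rw [jumpIntegral, jumpIntegral, jumpDivIntegral, key]
    simp [Real.zero_rpow ha.ne', Real.zero_rpow hb.ne']
  · refine Continuous.continuousOn ?_
    refine ((continuous_id.rpow_const fun _ => Or.inr ha.le).mul
      ((continuous_const.sub continuous_id).rpow_const fun _ => Or.inr hb.le)).mul ?_
    exact (continuous_jump hγ).comp (by fun_prop : Continuous fun x : ℝ => x - t)
  · intro x hx
    rw [min_eq_left zero_le_one, max_eq_right zero_le_one] at hx
    obtain ⟨⟨hx0, hx1⟩, hxt⟩ := hx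
    have hxt' : x - t ≠ 0 := sub_ne_zero.mpr hxt
    have h1 : HasDerivAt (fun x : ℝ => x ^ a) (1 * a * x ^ (a - 1)) x :=
      (hasDerivAt_id x).rpow_const (Or.inl hx0.ne')
    have h2 : HasDerivAt (fun x : ℝ => (1 - x) ^ b) (-1 * b * (1 - x) ^ (b - 1)) x :=
      ((hasDerivAt_id x).const_sub 1).rpow_const (Or.inl (sub_pos.mpr hx1).ne')
    have h3 : HasDerivAt (fun x : ℝ => jump γ A B (x - t))
        (γ * (jump γ A B (x - t) / (x - t))) x :=
      (hasDerivAt_jump hγ hxt').comp_sub_const x t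
    refine ((h1.mul h2).mul h3).congr_deriv ?_
    simp only [Pi.mul_apply]
    ring

/-- From `t = x - (x - t)`; the companion below uses `t - 1 = -(1 - x) - (x - t)`. -/
lemma mul_jumpDivIntegral (hγ : 0 < γ) (ha : -1 < a) (hb : -1 < b)
    (ht0 : 0 < t) (ht1 : t < 1) :
    t * jumpDivIntegral γ A B a b t
      = jumpDivIntegral γ A B (a + 1) b t - jumpIntegral γ A B a b t := by
  rw [jumpDivIntegral, jumpDivIntegral, jumpIntegral, ← intervalIntegral.integral_const_mul,
    ← intervalIntegral.integral_sub
      (intervalIntegrable_mul_jump_div hγ (by linarith) hb ht0 ht1)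
      (intervalIntegrable_mul_jump hγ ha hb t)]
  refine intervalIntegral.integral_congr fun x hx => ?_
  rw [uIcc_of_le zero_le_one] at hx
  rw [Real.rpow_add_one' hx.1 (by linarith)]
  linear_combination (-x ^ a * (1 - x) ^ b) * mul_jump_div_self (A := A) (B := B) hγ (x - t)

lemma sub_one_mul_jumpDivIntegral (hγ : 0 < γ) (ha : -1 < a) (hb : -1 < b)
    (ht0 : 0 < t) (ht1 : t < 1) :
    (t - 1) * jumpDivIntegral γ A B a b t
      = -jumpDivIntegral γ A B a (b + 1) t - jumpIntegral γ A B a b t := by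
  rw [jumpDivIntegral, jumpDivIntegral, jumpIntegral, ← intervalIntegral.integral_const_mul,
    neg_sub_left, ← intervalIntegral.integral_add (intervalIntegrable_mul_jump hγ ha hb t)
      (intervalIntegrable_mul_jump_div hγ ha (by linarith) ht0 ht1),
    ← intervalIntegral.integral_neg]
  refine intervalIntegral.integral_congr fun x hx => ?_
  rw [uIcc_of_le zero_le_one] at hx
  rw [Real.rpow_add_one' (sub_nonneg.mpr hx.2) (by linarith)]
  linear_combination (-x ^ a * (1 - x) ^ b) * mul_jump_div_self (A := A) (B := B) hγ (x - t)

/-- For `γ < 1` the singularity moves with `t` and has no fixed integrable majorant. Instead,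
raising both exponents by one and integrating by parts expresses the integral through continuous
ones, with denominator `s (1 - s)`. -/
lemma continuousAt_jumpDivIntegral (hγ : 0 < γ) (ha : -1 < a) (hb : -1 < b)
    (ht0 : 0 < t) (ht1 : t < 1) : ContinuousAt (jumpDivIntegral γ A B a b) t := by
  have key : jumpDivIntegral γ A B a b =ᶠ[𝓝 t] fun s =>
      (((b + 1) * jumpIntegral γ A B (a + 1) b s - (a + 1) * jumpIntegral γ A B a (b + 1) s) / γ
        - jumpIntegral γ A B a (b + 1) s + s * jumpIntegral γ A B a b s) / (s * (1 - s)) := by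
    filter_upwards [Ioo_mem_nhds ht0 ht1] with s ⟨hs0, hs1⟩
    have h1 := sub_one_mul_jumpDivIntegral (A := A) (B := B) hγ ha hb hs0 hs1
    have h2 := mul_jumpDivIntegral (A := A) (B := B) hγ ha (by linarith : -1 < b + 1) hs0 hs1
    have h3 := jump_integration_by_parts (A := A) (B := B) hγ (by linarith : 0 < a + 1)
      (by linarith : 0 < b + 1) hs0 hs1
    rw [add_sub_cancel_right, add_sub_cancel_right] at h3
    have h4 : 1 - s ≠ 0 := by linarith
    field_simp
    linear_combination (-s * γ) * h1 + γ * h2 + h3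
  refine ContinuousAt.congr ?_ key.symm
  have c1 := continuousAt_jumpIntegral (A := A) (B := B) hγ (by linarith : -1 < a + 1) hb ht0 ht1
  have c2 := continuousAt_jumpIntegral (A := A) (B := B) hγ ha (by linarith : -1 < b + 1) ht0 ht1
  have c3 := continuousAt_jumpIntegral (A := A) (B := B) hγ ha hb ht0 ht1
  have h5 : t * (1 - t) ≠ 0 := mul_ne_zero ht0.ne' (by linarith)
  fun_prop (disch := assumption)

/-- Up to truncation this is the integrand `f x * g (s - x)` of a convolution of two integrable
functions. -/
lemma integrableOn_mul_jump_div (hγ : 0 < γ) (ha : -1 < a) (hb : -1 < b) {s₁ s₂ : ℝ}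
    (h₁ : s₁ ∈ Icc (0 : ℝ) 1) (h₂ : s₂ ∈ Icc (0 : ℝ) 1) :
    IntegrableOn (Function.uncurry fun s x : ℝ =>
      x ^ a * (1 - x) ^ b * (jump γ A B (x - s) / (x - s))) (uIoc s₁ s₂ ×ˢ uIoc 0 1) := by
  have hf : Integrable (indicator (Ioc (0 : ℝ) 1) fun x => x ^ a * (1 - x) ^ b) :=
    (integrable_indicator_iff measurableSet_Ioc).mpr
      (intervalIntegrable_rpow_mul_one_sub_rpow ha hb).1
  have hg : Integrable (indicator (Ioc (-1 : ℝ) 1) fun v => jump γ A B (-v) / (-v)) := by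
    refine (integrable_indicator_iff measurableSet_Ioc).mpr ?_
    have := (IntervalIntegrable.iff_comp_neg (by simp)).mp
      (intervalIntegrable_jump_div (A := A) (B := B) hγ 1 (-1))
    rw [neg_neg] at this
    exact this.1
  have h := (hf.convolution_integrand (ContinuousLinearMap.mul ℝ ℝ) hg).integrableOn
    (s := uIoc s₁ s₂ ×ˢ uIoc 0 1)
  refine h.congr_fun (fun p hp => ?_) (measurableSet_uIoc.prod measurableSet_uIoc)
  obtain ⟨hp1, hp2⟩ := hp
  rw [uIoc_of_le zero_le_one] at hp2
  have hp3 : p.1 ∈ Ioc (0 : ℝ) 1 := by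
    refine ⟨lt_of_le_of_lt (le_min h₁.1 h₂.1) hp1.1, hp1.2.trans (max_le h₁.2 h₂.2)⟩
  have hp4 : p.1 - p.2 ∈ Ioc (-1 : ℝ) 1 := ⟨by linarith [hp3.1, hp2.2], by linarith [hp3.2, hp2.1]⟩
  simp [indicator_of_mem hp2, indicator_of_mem hp4, Function.uncurry]

/-- Fubini, followed by the fundamental theorem in `s` for each `x`. With continuity of the
right-hand integrand, this replaces differentiation under the integral sign. -/
lemma jumpIntegral_sub_jumpIntegral (hγ : 0 < γ) (ha : -1 < a) (hb : -1 < b) {s₁ s₂ : ℝ}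
    (h₁ : s₁ ∈ Icc (0 : ℝ) 1) (h₂ : s₂ ∈ Icc (0 : ℝ) 1) :
    jumpIntegral γ A B a b s₂ - jumpIntegral γ A B a b s₁
      = -γ * ∫ s in s₁..s₂, jumpDivIntegral γ A B a b s := by
  simp only [jumpDivIntegral]
  rw [intervalIntegral_intervalIntegral_swap (integrableOn_mul_jump_div hγ ha hb h₁ h₂),
    ← intervalIntegral.integral_const_mul, jumpIntegral, jumpIntegral,
    ← intervalIntegral.integral_sub (intervalIntegrable_mul_jump hγ ha hb _)
      (intervalIntegrable_mul_jump hγ ha hb _)]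
  refine intervalIntegral.integral_congr fun x _ => ?_
  simp only [intervalIntegral.integral_const_mul]
  rw [intervalIntegral.integral_comp_sub_left (fun u => jump γ A B u / u)]
  linear_combination (x ^ a * (1 - x) ^ b) * integral_jump_div (A := A) (B := B) hγ (x - s₂) (x - s₁)

lemma hasDerivAt_jumpIntegral (hγ : 0 < γ) (ha : -1 < a) (hb : -1 < b)
    (ht0 : 0 < t) (ht1 : t < 1) :
    HasDerivAt (jumpIntegral γ A B a b) (-γ * jumpDivIntegral γ A B a b t) t := by
  have hc : ContinuousOn (jumpDivIntegral γ A B a b) (Ioo 0 1) := fun s hs =>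
    (continuousAt_jumpDivIntegral hγ ha hb hs.1 hs.2).continuousWithinAt
  have h := ((intervalIntegral.integral_hasDerivAt_right (a := t) (b := t)
    (IntervalIntegrable.refl) (hc.stronglyMeasurableAtFilter isOpen_Ioo t ⟨ht0, ht1⟩)
    (continuousAt_jumpDivIntegral hγ ha hb ht0 ht1)).const_mul (-γ)).const_add
      (jumpIntegral γ A B a b t)
  refine h.congr_of_eventuallyEq ?_
  filter_upwards [Ioo_mem_nhds ht0 ht1] with s hs
  rw [← jumpIntegral_sub_jumpIntegral hγ ha hb ⟨ht0.le, ht1.le⟩ ⟨hs.1.le, hs.2.le⟩]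
  ring

end Calculus

end DegenerateJacobi
end

/-! ### Orthogonal polynomials of an abstract functional and their residues. -/

noncomputable section

namespace DegenerateJacobi

open Set Filter Topology Polynomial

/-- `Λ f = L (f / (X - s))`. -/
def IsDivided (L Λ : ℝ[X] →ₗ[ℝ] ℝ) (s : ℝ) : Prop :=
  ∀ f : ℝ[X], Λ ((X - C s) * f) = L f

lemma degree_divByMonic_X_sub_C_lt {g : ℝ[X]} {m : ℕ} (s : ℝ)
    (hg : g.degree < ((m + 1 : ℕ) : WithBot ℕ)) :
    (g /ₘ (X - C s)).degree < (m : WithBot ℕ) := by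
  rcases eq_or_ne g 0 with rfl | h0
  · simp
  · refine (degree_divByMonic_lt g (X - C s) h0 (by simp)).trans_le ?_
    rw [degree_eq_natDegree h0, Nat.cast_lt] at hg
    rw [degree_eq_natDegree h0, Nat.cast_le]
    exact Nat.lt_succ_iff.mp hg

lemma degree_derivative_lt_of_lt {g : ℝ[X]} {m : ℕ}
    (hg : g.degree < ((m + 1 : ℕ) : WithBot ℕ)) : (derivative g).degree < (m : WithBot ℕ) := by
  rw [degree_lt_iff_coeff_zero] at hg ⊢
  intro k hk
  rw [coeff_derivative, hg (k + 1) (by exact_mod_cast Nat.succ_le_succ hk), zero_mul]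

/-- Division with remainder: `g = g(s) + (X - s) q`. When `F` is orthogonal to the quotient, only
`g(s) Λ F` survives. -/
lemma IsDivided.apply_mul {L Λ : ℝ[X] →ₗ[ℝ] ℝ} {s : ℝ} (h : IsDivided L Λ s) (F g : ℝ[X]) :
    Λ (F * g) = g.eval s * Λ F + L (F * (g /ₘ (X - C s))) := by
  conv_lhs => rw [← modByMonic_add_div g (X - C s), modByMonic_X_sub_C_eq_C_eval]
  rw [mul_add, map_add, mul_comm F, ← smul_eq_C_mul, map_smul, smul_eq_mul, mul_left_comm, h]

/-- `P` and `R` are the orthogonal polynomials of degrees `m + 1` and `m` for the functional `L`,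
`P` being monic and `R` normalised by `L (R * X ^ m) = 1`, and `K s` is the reproducing kernel of
the polynomials of degree at most `m`, with one variable set to `s`. -/
structure IsOrthogonalSystem (L : ℝ[X] →ₗ[ℝ] ℝ) (m : ℕ) (P R : ℝ[X]) (K : ℝ → ℝ[X]) : Prop where
  degree_sub : (P - X ^ (m + 1)).degree < ((m + 1 : ℕ) : WithBot ℕ)
  degree_R : R.degree < ((m + 1 : ℕ) : WithBot ℕ)
  degree_K : ∀ s, (K s).degree < ((m + 1 : ℕ) : WithBot ℕ)
  apply_P : ∀ g : ℝ[X], g.degree < ((m + 1 : ℕ) : WithBot ℕ) → L (P * g) = 0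
  apply_R : ∀ g : ℝ[X], g.degree < ((m + 1 : ℕ) : WithBot ℕ) → L (R * g) = g.coeff m
  apply_K : ∀ s, ∀ g : ℝ[X], g.degree < ((m + 1 : ℕ) : WithBot ℕ) → L (K s * g) = g.eval s
  eq_zero : ∀ F : ℝ[X], F.degree < ((m + 1 : ℕ) : WithBot ℕ) →
    (∀ g : ℝ[X], g.degree < ((m + 1 : ℕ) : WithBot ℕ) → L (F * g) = 0) → F = 0

namespace IsOrthogonalSystem

variable {L L₀ L₁ Lt Λ : ℝ[X] →ₗ[ℝ] ℝ} {m : ℕ} {P R : ℝ[X]} {K : ℝ → ℝ[X]} {α β γ t s r : ℝ}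

lemma coeff_P (h : IsOrthogonalSystem L m P R K) : P.coeff (m + 1) = 1 := by
  have := (degree_lt_iff_coeff_zero _ _).mp h.degree_sub (m + 1) le_rfl
  rw [coeff_sub, coeff_X_pow_self] at this
  linarith

lemma coeff_P_of_lt (h : IsOrthogonalSystem L m P R K) {k : ℕ} (hk : m + 1 < k) :
    P.coeff k = 0 := by
  have := (degree_lt_iff_coeff_zero _ _).mp h.degree_sub k hk.le
  rwa [coeff_sub, coeff_X_pow, if_neg hk.ne', sub_zero] at this

lemma degree_P_lt (h : IsOrthogonalSystem L m P R K) :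
    P.degree < ((m + 1 + 1 : ℕ) : WithBot ℕ) :=
  (degree_lt_iff_coeff_zero _ _).mpr fun _ hk => h.coeff_P_of_lt hk

/-- `L (R * K s)` is computed in two ways, by the normalisation of `R` and by the reproducing
property. -/
lemma coeff_K (h : IsOrthogonalSystem L m P R K) : (K s).coeff m = R.eval s := by
  rw [← h.apply_R _ (h.degree_K s), mul_comm, h.apply_K s R h.degree_R]

lemma degree_X_sub_C_mul_sub_lt (h : IsOrthogonalSystem L m P R K) {g : ℝ[X]}
    (hg : g.degree < ((m + 1 : ℕ) : WithBot ℕ)) :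
    ((X - C s) * g - C (g.coeff m) * P).degree < ((m + 1 : ℕ) : WithBot ℕ) := by
  rw [degree_lt_iff_coeff_zero] at hg ⊢
  intro k hk
  obtain ⟨j, rfl⟩ : ∃ j, k = j + 1 := ⟨k - 1, by omega⟩
  have hk' : m ≤ j := by omega
  rw [coeff_sub, sub_mul, coeff_sub, coeff_X_mul, coeff_C_mul, coeff_C_mul, hg (j + 1) hk]
  rcases hk'.eq_or_lt with rfl | hlt
  · rw [h.coeff_P]; ring
  · rw [h.coeff_P_of_lt (by omega), hg j (by omega)]; ring

/-- The Christoffel–Darboux formula. -/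
lemma X_sub_C_mul_K (h : IsOrthogonalSystem L m P R K) (s : ℝ) :
    (X - C s) * K s = C (R.eval s) * P - C (P.eval s) * R := by
  rw [← sub_eq_zero]
  -- By `coeff_K` the terms of degree `m + 1` cancel, so it is enough to test against `g` of degree
  -- at most `m`.
  refine h.eq_zero _ ?_ fun g hg => ?_
  · have h1 := h.degree_X_sub_C_mul_sub_lt (s := s) (h.degree_K s)
    rw [h.coeff_K] at h1
    have h2 : (C (P.eval s) * R).degree < ((m + 1 : ℕ) : WithBot ℕ) :=
      (smul_eq_C_mul (P.eval s) (p := R)) ▸ (degree_smul_le _ _).trans_lt h.degree_R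
    rw [show (X - C s) * K s - (C (R.eval s) * P - C (P.eval s) * R)
      = ((X - C s) * K s - C (R.eval s) * P) + C (P.eval s) * R by ring]
    exact (degree_add_le _ _).trans_lt (max_lt h1 h2)
  · have h1 := h.apply_K s _ (h.degree_X_sub_C_mul_sub_lt (s := s) hg)
    have h2 : L (K s * P) = 0 := by rw [mul_comm, h.apply_P _ (h.degree_K s)]
    -- Subtracting a multiple of `P`, which is orthogonal to `K s`, brings `(X - s) g` into the
    -- range where `K s` reproduces.
    have h3 : ((X - C s) * K s - (C (R.eval s) * P - C (P.eval s) * R)) * g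
      = K s * ((X - C s) * g - C (g.coeff m) * P) + g.coeff m • (K s * P)
        - R.eval s • (P * g) + P.eval s • (R * g) := by
      simp only [smul_eq_C_mul]; ring
    rw [h3]
    simp only [map_add, map_sub, map_smul, h1, h2, h.apply_P g hg, h.apply_R g hg]
    simp
    ring

lemma apply_K_one (h : IsOrthogonalSystem L m P R K) (s : ℝ) : L (K s) = 1 := by
  have := h.apply_K s 1 (by
    rw [degree_one]; exact_mod_cast Nat.succ_pos m)
  simpa using this

/-- The bilinear combination of values and divided functionals is an incomplete Casoratian. -/
lemma casoratian (h : IsOrthogonalSystem L m P R K) (hΛ : IsDivided L Λ r) (s : ℝ) :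
    R.eval s * Λ P - P.eval s * Λ R = 1 + (r - s) * Λ (K s) := by
  have h1 := congrArg Λ (h.X_sub_C_mul_K s)
  -- The part with `X - r` contributes `L (K s) = 1`.
  have h2 : (X - C s) * K s = (X - C r) * K s + (r - s) • K s := by
    rw [smul_eq_C_mul, C_sub]; ring
  rw [h2, map_add, hΛ, map_smul, h.apply_K_one, ← smul_eq_C_mul, ← smul_eq_C_mul, map_sub,
    map_smul, map_smul] at h1
  simp only [smul_eq_mul] at h1
  exact h1.symm

/-- This is the source of `y z = x (x - 1)`: with `x = R(s) Λ P`, it says `x - 1 = P(s) Λ R`. -/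
lemma casoratian_self (h : IsOrthogonalSystem L m P R K) (hΛ : IsDivided L Λ s) :
    R.eval s * Λ P - P.eval s * Λ R = 1 := by
  rw [h.casoratian hΛ s]; ring

lemma sub_mul_eval_K (h : IsOrthogonalSystem L m P R K) (s r : ℝ) :
    (r - s) * (K s).eval r = R.eval s * P.eval r - P.eval s * R.eval r := by
  simpa using congrArg (eval r) (h.X_sub_C_mul_K s)

lemma apply_P_mul (h : IsOrthogonalSystem L m P R K) (hΛ : IsDivided L Λ s) {g : ℝ[X]}
    (hg : g.degree < ((m + 1 + 1 : ℕ) : WithBot ℕ)) : Λ (P * g) = g.eval s * Λ P := by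
  rw [hΛ.apply_mul, h.apply_P _ (degree_divByMonic_X_sub_C_lt s hg), add_zero]

lemma apply_R_of_degree_lt (h : IsOrthogonalSystem L m P R K) {g : ℝ[X]}
    (hg : g.degree < (m : WithBot ℕ)) : L (R * g) = 0 := by
  rw [h.apply_R _ (hg.trans (by exact_mod_cast Nat.lt_succ_self m))]
  exact coeff_eq_zero_of_degree_lt hg

lemma apply_R_mul (h : IsOrthogonalSystem L m P R K) (hΛ : IsDivided L Λ s) {g : ℝ[X]}
    (hg : g.degree < ((m + 1 : ℕ) : WithBot ℕ)) : Λ (R * g) = g.eval s * Λ R := by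
  rw [hΛ.apply_mul, h.apply_R_of_degree_lt (degree_divByMonic_X_sub_C_lt s hg), add_zero]

section Pearson

variable (h : IsOrthogonalSystem L m P R K)
  (h₀ : IsDivided L L₀ 0) (h₁ : IsDivided L L₁ 1) (ht : IsDivided L Lt t)
  (hpearson : ∀ f : ℝ[X], L (derivative f) + α * L₀ f + β * L₁ f + γ * Lt f = 0)

include h h₀ h₁ ht hpearson

/-- Apply Pearson to `F * g`: `L (F g')` vanishes and each divided functional gives `g(c) Λ F`,
which is `L` of `g` times a multiple of `K c`. -/
lemma derivative_eq_of_apply_mul {F : ℝ[X]} (hF : (derivative F).degree < ((m + 1 : ℕ) : WithBot ℕ))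
    (hL : ∀ g : ℝ[X], g.degree < (m : WithBot ℕ) → L (F * g) = 0) :
    derivative F = -((α * L₀ F) • K 0 + (β * L₁ F) • K 1 + (γ * Lt F) • K t) := by
  rw [← add_eq_zero_iff_eq_neg]
  have hdeg : ∀ (c s : ℝ), (c • K s).degree < ((m + 1 : ℕ) : WithBot ℕ) := fun c s =>
    (degree_smul_le _ _).trans_lt (h.degree_K s)
  refine h.eq_zero _ ?_ fun g hg => ?_
  · refine (degree_add_le _ _).trans_lt (max_lt hF ?_)
    refine (degree_add_le _ _).trans_lt (max_lt ?_ (hdeg _ _))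
    exact (degree_add_le _ _).trans_lt (max_lt (hdeg _ _) (hdeg _ _))
  · have key : ∀ {Λ : ℝ[X] →ₗ[ℝ] ℝ} {s : ℝ}, IsDivided L Λ s → Λ (F * g) = g.eval s * Λ F :=
      fun {Λ s} hΛ => by
        rw [hΛ.apply_mul, hL _ (degree_divByMonic_X_sub_C_lt s hg), add_zero]
    have h1 := hpearson (F * g)
    rw [derivative_mul, map_add, hL _ (degree_derivative_lt_of_lt hg), key h₀, key h₁, key ht] at h1
    simp only [add_mul, smul_mul_assoc, map_add, map_smul, h.apply_K _ g hg, smul_eq_mul]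
    linear_combination h1

lemma derivative_P :
    derivative P = -((α * L₀ P) • K 0 + (β * L₁ P) • K 1 + (γ * Lt P) • K t) :=
  h.derivative_eq_of_apply_mul h₀ h₁ ht hpearson (degree_derivative_lt_of_lt h.degree_P_lt)
    fun g hg => h.apply_P g (hg.trans (by exact_mod_cast Nat.lt_succ_self m))

lemma derivative_R :
    derivative R = -((α * L₀ R) • K 0 + (β * L₁ R) • K 1 + (γ * Lt R) • K t) :=
  h.derivative_eq_of_apply_mul h₀ h₁ ht hpearson
    ((degree_derivative_lt_of_lt h.degree_R).trans (by exact_mod_cast Nat.lt_succ_self m))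
    fun _ hg => h.apply_R_of_degree_lt hg

/-- Pearson applied to `P * R`; the term `m + 1` is the leading coefficient of `P'`. For `P * P` and
`R * R` no such term survives, so the residues sum to a diagonal matrix. -/
lemma sum_residue_PR :
    α * (R.eval 0 * L₀ P) + β * (R.eval 1 * L₁ P) + γ * (R.eval t * Lt P) = -(m + 1 : ℝ) := by
  have hR : R.degree < ((m + 1 + 1 : ℕ) : WithBot ℕ) :=
    h.degree_R.trans (by exact_mod_cast Nat.lt_succ_self (m + 1))
  have h1 := hpearson (P * R)
  rw [derivative_mul, map_add, h.apply_P _ (degree_derivative_lt_of_lt hR),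
    mul_comm (derivative P), h.apply_R _ (degree_derivative_lt_of_lt h.degree_P_lt),
    coeff_derivative, h.coeff_P, h.apply_P_mul h₀ hR, h.apply_P_mul h₁ hR, h.apply_P_mul ht hR]
    at h1
  linear_combination h1

lemma sum_residue_PP :
    α * (P.eval 0 * L₀ P) + β * (P.eval 1 * L₁ P) + γ * (P.eval t * Lt P) = 0 := by
  have h1 := hpearson (P * P)
  rw [derivative_mul, map_add, mul_comm (derivative P),
    h.apply_P _ (degree_derivative_lt_of_lt h.degree_P_lt),
    h.apply_P_mul h₀ h.degree_P_lt, h.apply_P_mul h₁ h.degree_P_lt, h.apply_P_mul ht h.degree_P_lt]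
    at h1
  linear_combination h1

lemma sum_residue_RR :
    α * (R.eval 0 * L₀ R) + β * (R.eval 1 * L₁ R) + γ * (R.eval t * Lt R) = 0 := by
  have h1 := hpearson (R * R)
  rw [derivative_mul, map_add, mul_comm (derivative R),
    h.apply_R_of_degree_lt (degree_derivative_lt_of_lt h.degree_R),
    h.apply_R_mul h₀ h.degree_R, h.apply_R_mul h₁ h.degree_R, h.apply_R_mul ht h.degree_R]
    at h1
  linear_combination h1

end Pearson

/-- The confluent case of `casoratian`. -/
lemma neg_apply_K_self (h : IsOrthogonalSystem L m P R K) (ht : IsDivided L Lt t)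
    (hcont : ContinuousAt (fun s => Lt (K s)) t) :
    -Lt (K t) = (derivative R).eval t * Lt P - (derivative P).eval t * Lt R := by
  have h1 : HasDerivAt (fun s => R.eval s * Lt P - P.eval s * Lt R)
      ((derivative R).eval t * Lt P - (derivative P).eval t * Lt R) t :=
    ((R.hasDerivAt t).mul_const _).sub ((P.hasDerivAt t).mul_const _)
  rw [hasDerivAt_iff_tendsto_slope] at h1
  -- By `casoratian` with `r = t`, the difference quotient at `t` is exactly `-Lt (K s)`.
  refine tendsto_nhds_unique (Tendsto.congr' ?_ (hcont.tendsto.neg.mono_left nhdsWithin_le_nhds)) h1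
  filter_upwards [self_mem_nhdsWithin] with s hs
  have hs' : s - t ≠ 0 := sub_ne_zero.mpr hs
  rw [slope_def_field, h.casoratian ht s, h.casoratian ht t]
  field_simp
  ring

/-- The divided functional of the reproducing kernel on the diagonal, in terms of residues. -/
lemma apply_K_self (h : IsOrthogonalSystem L m P R K)
    (h₀ : IsDivided L L₀ 0) (h₁ : IsDivided L L₁ 1) (ht : IsDivided L Lt t)
    (hpearson : ∀ f : ℝ[X], L (derivative f) + α * L₀ f + β * L₁ f + γ * Lt f = 0)
    (hcont : ContinuousAt (fun s => Lt (K s)) t) :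
    t * (t - 1) * -Lt (K t) =
      (t - 1) * (α * ((P.eval t * R.eval 0 - R.eval t * P.eval 0) * (L₀ P * Lt R - L₀ R * Lt P)))
      + t * (β * ((P.eval t * R.eval 1 - R.eval t * P.eval 1) * (L₁ P * Lt R - L₁ R * Lt P))) := by
  -- The `K t` terms of `P'` and `R'` cancel; Christoffel–Darboux evaluates `K 0` and `K 1` at `t`.
  rw [h.neg_apply_K_self ht hcont, h.derivative_P h₀ h₁ ht hpearson,
    h.derivative_R h₀ h₁ ht hpearson]
  have e0 := h.sub_mul_eval_K 0 t
  have e1 := h.sub_mul_eval_K 1 t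
  simp only [eval_neg, eval_add, eval_smul, smul_eq_mul]
  linear_combination ((t - 1) * α * (L₀ P * Lt R - L₀ R * Lt P)) * e0
    + (t * β * (L₁ P * Lt R - L₁ R * Lt P)) * e1

end IsOrthogonalSystem

end DegenerateJacobi
end

/-! ### Hankel matrices: existence of the orthogonal system, and a trace formula. -/

noncomputable section

namespace DegenerateJacobi

open Set Filter Topology Polynomial Matrix

/-- The Hankel matrix of the functional `L`. -/
def hankelMatrix (L : ℝ[X] →ₗ[ℝ] ℝ) (n : ℕ) : Matrix (Fin n) (Fin n) ℝ :=
  Matrix.of fun i j => L (X ^ ((i : ℕ) + (j : ℕ)))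

/-- The polynomial of degree less than `n` that represents the functional
`X ^ k ↦ u k` with respect to `L`. -/
def hankelRep (L : ℝ[X] →ₗ[ℝ] ℝ) (n : ℕ) (u : Fin n → ℝ) : ℝ[X] :=
  ∑ i : Fin n, C (((hankelMatrix L n)⁻¹ *ᵥ u) i) * X ^ (i : ℕ)

/-- The monic orthogonal polynomial of degree `m + 1`. -/
def orthoMonic (L : ℝ[X] →ₗ[ℝ] ℝ) (m : ℕ) : ℝ[X] :=
  X ^ (m + 1) - hankelRep L (m + 1) fun k => L (X ^ (m + 1 + (k : ℕ)))

/-- The orthogonal polynomial of degree `m`, normalised by `L (R * X ^ m) = 1`. -/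
def orthoDual (L : ℝ[X] →ₗ[ℝ] ℝ) (m : ℕ) : ℝ[X] :=
  hankelRep L (m + 1) (Pi.single (Fin.last m) 1)

/-- The reproducing kernel of the polynomials of degree at most `m`. -/
def orthoKernel (L : ℝ[X] →ₗ[ℝ] ℝ) (m : ℕ) (s : ℝ) : ℝ[X] :=
  hankelRep L (m + 1) fun k => s ^ (k : ℕ)

variable {L Λ : ℝ[X] →ₗ[ℝ] ℝ} {n m : ℕ}

lemma eq_sum_fin_of_degree_lt {g : ℝ[X]} (hg : g.degree < (n : WithBot ℕ)) :
    g = ∑ i : Fin n, C (g.coeff i) * X ^ (i : ℕ) := by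
  rw [Polynomial.sum_fin (fun i a => C a * X ^ i) (by simp) hg, sum_C_mul_X_pow_eq]

lemma hankelMatrix_transpose : (hankelMatrix L n)ᵀ = hankelMatrix L n := by
  ext i j
  simp [hankelMatrix, add_comm]

lemma degree_hankelRep_lt (u : Fin n → ℝ) : (hankelRep L n u).degree < (n : WithBot ℕ) :=
  degree_sum_fin_lt _

lemma dotProduct_hankelMatrix_mulVec (u v : Fin n → ℝ) :
    v ⬝ᵥ hankelMatrix L n *ᵥ u
      = L ((∑ i : Fin n, C (u i) * X ^ (i : ℕ)) * ∑ i : Fin n, C (v i) * X ^ (i : ℕ)) := by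
  rw [Finset.sum_mul_sum]
  simp only [dotProduct, mulVec, Finset.mul_sum, map_sum]
  rw [Finset.sum_comm]
  refine Finset.sum_congr rfl fun j _ => Finset.sum_congr rfl fun i _ => ?_
  rw [show C (u j) * X ^ (j : ℕ) * (C (v i) * X ^ (i : ℕ))
    = (u j * v i) • (X ^ ((i : ℕ) + (j : ℕ)) : ℝ[X]) by rw [smul_eq_C_mul, C_mul]; ring]
  rw [map_smul, hankelMatrix, of_apply, smul_eq_mul]
  ring

lemma hankelMatrix_posDef (hpos : ∀ f : ℝ[X], f ≠ 0 → 0 < L (f * f)) :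
    (hankelMatrix L n).PosDef := by
  refine PosDef.of_dotProduct_mulVec_pos (by
    rw [IsHermitian, conjTranspose_eq_transpose_of_trivial, hankelMatrix_transpose]) fun u hu => ?_
  rw [star_trivial, dotProduct_hankelMatrix_mulVec]
  refine hpos _ fun h => hu (funext fun i => ?_)
  have := congrArg (fun p => p.coeff (i : ℕ)) h
  simpa [finsetSum_coeff, coeff_X_pow, Fin.val_inj] using this

lemma hankelMatrix_det_pos (hpos : ∀ f : ℝ[X], f ≠ 0 → 0 < L (f * f)) :
    0 < (hankelMatrix L n).det := (hankelMatrix_posDef hpos).det_pos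

lemma apply_hankelRep_mul (hdet : IsUnit (hankelMatrix L n).det) (u : Fin n → ℝ) {g : ℝ[X]}
    (hg : g.degree < (n : WithBot ℕ)) :
    L (hankelRep L n u * g) = ∑ k : Fin n, g.coeff k * u k := by
  conv_lhs => rw [eq_sum_fin_of_degree_lt hg]
  rw [hankelRep, ← dotProduct_hankelMatrix_mulVec, mulVec_mulVec, mul_nonsing_inv _ hdet,
    one_mulVec]
  rfl

lemma sum_coeff_mul_pow {g : ℝ[X]} (hg : g.degree < (n : WithBot ℕ)) (s : ℝ) :
    ∑ k : Fin n, g.coeff k * s ^ (k : ℕ) = g.eval s := by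
  conv_rhs => rw [eq_sum_fin_of_degree_lt hg]
  simp [eval_finsetSum]

lemma isOrthogonalSystem (hpos : ∀ f : ℝ[X], f ≠ 0 → 0 < L (f * f)) (m : ℕ) :
    IsOrthogonalSystem L m (orthoMonic L m) (orthoDual L m) (orthoKernel L m) := by
  have hdet : IsUnit (hankelMatrix L (m + 1)).det := (hankelMatrix_det_pos hpos).ne'.isUnit
  refine ⟨?_, degree_hankelRep_lt _, fun s => degree_hankelRep_lt _, fun g hg => ?_,
    fun g hg => ?_, fun s g hg => ?_, fun F hF h => ?_⟩
  · rw [orthoMonic, sub_sub_cancel_left, degree_neg]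
    exact degree_hankelRep_lt _
  · rw [orthoMonic, sub_mul, map_sub, apply_hankelRep_mul hdet _ hg, sub_eq_zero]
    conv_lhs => rw [eq_sum_fin_of_degree_lt hg]
    rw [Finset.mul_sum, map_sum]
    refine Finset.sum_congr rfl fun k _ => ?_
    rw [mul_left_comm, ← pow_add, ← smul_eq_C_mul, map_smul, smul_eq_mul]
  · rw [orthoDual, apply_hankelRep_mul hdet _ hg]
    simp [Pi.single_apply]
  · rw [orthoKernel, apply_hankelRep_mul hdet _ hg, sum_coeff_mul_pow hg]
  · by_contra hne
    exact (hpos F hne).ne' (h F hF)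

lemma apply_hankelRep (u : Fin n → ℝ) :
    Λ (hankelRep L n u) = ∑ i : Fin n, ((hankelMatrix L n)⁻¹ *ᵥ u) i * Λ (X ^ (i : ℕ)) := by
  simp only [hankelRep, map_sum, ← smul_eq_C_mul, map_smul, smul_eq_mul]

lemma continuous_apply_orthoKernel : Continuous fun s => Λ (orthoKernel L m s) := by
  simp only [orthoKernel, apply_hankelRep, mulVec, dotProduct]
  fun_prop

/-- The trace of the inverse Hankel matrix against the Hankel matrix of `f ↦ L (f / (X - t))`. -/
lemma trace_inv_mul_hankelMatrix (hdet : IsUnit (hankelMatrix L (m + 1)).det) {t : ℝ}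
    (hΛ : IsDivided L Λ t) :
    ((hankelMatrix L (m + 1))⁻¹ * hankelMatrix Λ (m + 1)).trace = Λ (orthoKernel L m t) := by
  set N := (hankelMatrix L (m + 1))⁻¹ with hN
  -- Dividing `X ^ k` by `X - t` writes the Hankel matrix of `Λ` as a rank-one matrix plus `Q` times
  -- that of `L`, with `Q` the matrix of quotient coefficients.
  have key : ∀ i k : Fin (m + 1), Λ (X ^ ((k : ℕ) + (i : ℕ))) = t ^ (k : ℕ) * Λ (X ^ (i : ℕ))
      + ∑ l : Fin (m + 1), (X ^ (k : ℕ) /ₘ (X - C t)).coeff l * hankelMatrix L (m + 1) l i := by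
    intro i k
    rw [add_comm, pow_add, hΛ.apply_mul, eval_pow, eval_X]
    congr 1
    have hd : (X ^ (k : ℕ) /ₘ (X - C t) : ℝ[X]).degree < ((m + 1 : ℕ) : WithBot ℕ) := by
      refine (degree_divByMonic_le _ _).trans_lt ?_
      rw [degree_X_pow]
      exact_mod_cast k.2
    conv_lhs => rw [eq_sum_fin_of_degree_lt hd]
    rw [Finset.mul_sum, map_sum]
    refine Finset.sum_congr rfl fun l _ => ?_
    rw [mul_left_comm, ← pow_add, ← smul_eq_C_mul, map_smul, smul_eq_mul, hankelMatrix, of_apply,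
      Nat.add_comm (i : ℕ) (l : ℕ)]
  -- The trace of `Q` is `0`: the quotient of `X ^ k` has degree below `k`, so `Q` has zero
  -- diagonal.
  have hzero : ∑ i : Fin (m + 1), ∑ k : Fin (m + 1), N i k *
      ∑ l : Fin (m + 1), (X ^ (k : ℕ) /ₘ (X - C t)).coeff l * hankelMatrix L (m + 1) l i = 0 := by
    calc _ = ∑ k : Fin (m + 1), ∑ l : Fin (m + 1), (X ^ (k : ℕ) /ₘ (X - C t)).coeff l *
          (hankelMatrix L (m + 1) * N) l k := by
          rw [Finset.sum_comm]
          refine Finset.sum_congr rfl fun k _ => ?_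
          simp only [Finset.mul_sum, mul_apply]
          rw [Finset.sum_comm]
          refine Finset.sum_congr rfl fun l _ => Finset.sum_congr rfl fun i _ => by ring
      _ = 0 := by
          rw [hN, mul_nonsing_inv _ hdet]
          refine Finset.sum_eq_zero fun k _ => Finset.sum_eq_zero fun l _ => ?_
          rw [one_apply]
          split_ifs with hlk
          · subst hlk
            rw [mul_one]
            refine coeff_eq_zero_of_degree_lt ?_
            obtain ⟨l, hl⟩ := l
            refine degree_divByMonic_X_sub_C_lt t ?_
            rw [degree_X_pow]
            exact_mod_cast Nat.lt_succ_self l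
          · rw [mul_zero]
  rw [orthoKernel, apply_hankelRep]
  simp only [trace, diag_apply, mul_apply]
  calc _ = ∑ i : Fin (m + 1), ∑ k : Fin (m + 1), N i k * (t ^ (k : ℕ) * Λ (X ^ (i : ℕ))) := by
        rw [← add_zero (∑ i : Fin (m + 1), ∑ k : Fin (m + 1), N i k * (t ^ (k : ℕ) * Λ (X ^ (i : ℕ)))),
          ← hzero, ← Finset.sum_add_distrib]
        refine Finset.sum_congr rfl fun i _ => ?_
        rw [← Finset.sum_add_distrib]
        refine Finset.sum_congr rfl fun k _ => ?_
        rw [← mul_add, ← key]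
        simp [hankelMatrix]
    _ = _ := by
        refine Finset.sum_congr rfl fun i _ => ?_
        rw [mulVec, dotProduct, Finset.sum_mul]
        exact Finset.sum_congr rfl fun k _ => by ring

/-- Jacobi's formula. -/
lemma hasDerivAt_det {M : ℝ → Matrix (Fin n) (Fin n) ℝ} {M' : Matrix (Fin n) (Fin n) ℝ} {t : ℝ}
    (h : ∀ i j, HasDerivAt (fun s => M s i j) (M' i j) t) :
    HasDerivAt (fun s => (M s).det) ((adjugate (M t) * M').trace) t := by
  have h1 : HasDerivAt (fun s => (M s).det) (∑ σ : Equiv.Perm (Fin n), (Equiv.Perm.sign σ : ℝ) *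
      ∑ i, (∏ j ∈ Finset.univ.erase i, M t (σ j) j) * M' (σ i) i) t := by
    simp only [det_apply']
    refine HasDerivAt.fun_sum fun σ _ => HasDerivAt.const_mul _ ?_
    simpa only [smul_eq_mul] using HasDerivAt.fun_finsetProd (u := Finset.univ) fun i _ => h (σ i) i
  refine h1.congr_deriv ?_
  simp only [Finset.mul_sum]
  rw [Finset.sum_comm, trace]
  refine Finset.sum_congr rfl fun i _ => ?_
  have h2 : (adjugate (M t) * M') i i = cramer (M t) (fun k => M' k i) i := by
    rw [cramer_eq_adjugate_mulVec]; rfl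
  rw [diag_apply, h2, cramer_apply, det_apply']
  refine Finset.sum_congr rfl fun σ _ => ?_
  rw [← Finset.mul_prod_erase _ _ (Finset.mem_univ i), updateCol_self]
  rw [mul_comm (M' (σ i) i)]
  congr 2
  refine Finset.prod_congr rfl fun j hj => ?_
  rw [updateCol_ne (Finset.ne_of_mem_erase hj)]

end DegenerateJacobi
end

/-! ### Deformation in `t` and the Schlesinger equations. -/

noncomputable section

namespace DegenerateJacobi

open Set Filter Topology Polynomial Matrix

/-- A family of functionals `L t` on polynomials with the properties of integration against the
weight `x^α (1-x)^β |x-t|^γ (A + B θ(x-t))`, together with the functionals `f ↦ L t (f / x)`,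
`f ↦ L t (f / (x - 1))` and `f ↦ L t (f / (x - t))`. -/
structure IsJacobiFamily (α β γ : ℝ) (L L₀ L₁ Lt : ℝ → ℝ[X] →ₗ[ℝ] ℝ) : Prop where
  pos : ∀ t ∈ Ioo (0 : ℝ) 1, ∀ f : ℝ[X], f ≠ 0 → 0 < L t (f * f)
  divided_zero : ∀ t ∈ Ioo (0 : ℝ) 1, IsDivided (L t) (L₀ t) 0
  divided_one : ∀ t ∈ Ioo (0 : ℝ) 1, IsDivided (L t) (L₁ t) 1
  divided_self : ∀ t ∈ Ioo (0 : ℝ) 1, IsDivided (L t) (Lt t) t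
  pearson : ∀ t ∈ Ioo (0 : ℝ) 1, ∀ f : ℝ[X],
    L t (derivative f) + α * L₀ t f + β * L₁ t f + γ * Lt t f = 0
  hasDerivAt : ∀ t ∈ Ioo (0 : ℝ) 1, ∀ f : ℝ[X], HasDerivAt (fun s => L s f) (-γ * Lt t f) t
  -- Partial fractions of `1 / (x (x - t))`; `t - 0` is kept so that one statement serves both poles
  -- `c = 0, 1`.
  hasDerivAt_zero : ∀ t ∈ Ioo (0 : ℝ) 1, ∀ f : ℝ[X],
    HasDerivAt (fun s => L₀ s f) (-γ / (t - 0) * (Lt t f - L₀ t f)) t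
  hasDerivAt_one : ∀ t ∈ Ioo (0 : ℝ) 1, ∀ f : ℝ[X],
    HasDerivAt (fun s => L₁ s f) (-γ / (t - 1) * (Lt t f - L₁ t f)) t

section Families

variable {t : ℝ} {n : ℕ}

lemma hasDerivAt_apply_polynomial {Λ : ℝ → ℝ[X] →ₗ[ℝ] ℝ} {Λ' : ℝ[X] →ₗ[ℝ] ℝ} {F : ℝ → ℝ[X]}
    {F' : ℝ[X]} (hΛ : ∀ p, HasDerivAt (fun s => Λ s p) (Λ' p) t)
    (hF : ∀ s, (F s).degree < (n : WithBot ℕ)) (hF' : F'.degree < (n : WithBot ℕ))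
    (hc : ∀ k, HasDerivAt (fun s => (F s).coeff k) (F'.coeff k) t) :
    HasDerivAt (fun s => Λ s (F s)) (Λ' (F t) + Λ t F') t := by
  have key : ∀ (Φ : ℝ[X] →ₗ[ℝ] ℝ) (p : ℝ[X]), p.degree < (n : WithBot ℕ) →
      Φ p = ∑ k : Fin n, p.coeff k * Φ (X ^ (k : ℕ)) := fun Φ p hp => by
    conv_lhs => rw [eq_sum_fin_of_degree_lt hp]
    simp only [map_sum, ← smul_eq_C_mul, map_smul, smul_eq_mul]
  have h1 : (fun s => Λ s (F s)) = fun s => ∑ k : Fin n, (F s).coeff k * Λ s (X ^ (k : ℕ)) :=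
    funext fun s => key _ _ (hF s)
  rw [h1, key Λ' _ (hF t), key (Λ t) _ hF', ← Finset.sum_add_distrib]
  refine HasDerivAt.fun_sum fun k _ => ?_
  exact ((hc k).mul (hΛ (X ^ (k : ℕ)))).congr_deriv (by ring)

lemma exists_polynomial_hasDerivAt {F : ℝ → ℝ[X]} (hF : ∀ s, (F s).degree < (n : WithBot ℕ))
    (hc : ∀ k, DifferentiableAt ℝ (fun s => (F s).coeff k) t) :
    ∃ F' : ℝ[X], F'.degree < (n : WithBot ℕ) ∧
      ∀ k, HasDerivAt (fun s => (F s).coeff k) (F'.coeff k) t := by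
  have h0 : ∀ k, n ≤ k → deriv (fun s => (F s).coeff k) t = 0 := fun k hk => by
    have : (fun s => (F s).coeff k) = fun _ => 0 :=
      funext fun s => (degree_lt_iff_coeff_zero _ _).mp (hF s) k hk
    rw [this, deriv_const]
  refine ⟨∑ i : Fin n, C (deriv (fun s => (F s).coeff i) t) * X ^ (i : ℕ), degree_sum_fin_lt _,
    fun k => (hc k).hasDerivAt.congr_deriv ?_⟩
  simp only [finsetSum_coeff, coeff_C_mul, coeff_X_pow, mul_ite, mul_one, mul_zero]
  by_cases hk : k < n
  · rw [Finset.sum_eq_single (⟨k, hk⟩ : Fin n)]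
    · simp
    · intro b _ hb
      rw [if_neg fun h => hb (Fin.ext h.symm)]
    · simp
  · rw [h0 k (not_lt.mp hk), Finset.sum_eq_zero]
    intro b _
    rw [if_neg fun h => hk (h.trans_lt b.2)]

/-- Cramer's rule: the entries are quotients of determinants. -/
lemma differentiableAt_inv_apply {M : ℝ → Matrix (Fin n) (Fin n) ℝ}
    (h : ∀ i j, DifferentiableAt ℝ (fun s => M s i j) t) (hdet : (M t).det ≠ 0) (i j : Fin n) :
    DifferentiableAt ℝ (fun s => (M s)⁻¹ i j) t := by
  have hd : ∀ N : ℝ → Matrix (Fin n) (Fin n) ℝ, (∀ i j, DifferentiableAt ℝ (fun s => N s i j) t) →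
      DifferentiableAt ℝ (fun s => (N s).det) t := fun N hN =>
    (hasDerivAt_det (M' := Matrix.of fun i j => deriv (fun s => N s i j) t)
      fun i j => (hN i j).hasDerivAt).differentiableAt
  simp only [inv_def, Ring.inverse_eq_inv', Matrix.smul_apply, smul_eq_mul, adjugate_apply]
  refine ((hd M h).inv hdet).mul (hd (fun s => (M s).updateRow j (Pi.single i 1)) fun k l => ?_)
  simp only [updateRow_apply]
  split_ifs
  · exact differentiableAt_const _
  · exact h k l

lemma exists_hankelRep_hasDerivAt {L : ℝ → ℝ[X] →ₗ[ℝ] ℝ} {u : ℝ → Fin n → ℝ}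
    (hL : ∀ p, DifferentiableAt ℝ (fun s => L s p) t) (hdet : (hankelMatrix (L t) n).det ≠ 0)
    (hu : ∀ k, DifferentiableAt ℝ (fun s => u s k) t) :
    ∃ F' : ℝ[X], F'.degree < (n : WithBot ℕ) ∧
      ∀ k, HasDerivAt (fun s => (hankelRep (L s) n (u s)).coeff k) (F'.coeff k) t := by
  refine exists_polynomial_hasDerivAt (fun s => degree_hankelRep_lt _) fun k => ?_
  simp only [hankelRep, finsetSum_coeff, coeff_C_mul, mulVec, dotProduct]
  have h1 : ∀ i j, DifferentiableAt ℝ (fun s => (hankelMatrix (L s) n)⁻¹ i j) t :=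
    differentiableAt_inv_apply (fun i j => hL (X ^ ((i : ℕ) + (j : ℕ)))) hdet
  refine DifferentiableAt.fun_sum fun i _ => DifferentiableAt.mul_const ?_ _
  exact DifferentiableAt.fun_sum fun j _ => (h1 i j).mul (hu j)

end Families

namespace IsJacobiFamily

variable {α β γ t : ℝ} {L L₀ L₁ Lt : ℝ → ℝ[X] →ₗ[ℝ] ℝ} {m : ℕ}

lemma system (h : IsJacobiFamily α β γ L L₀ L₁ Lt) (ht : t ∈ Ioo (0 : ℝ) 1) (m : ℕ) :
    IsOrthogonalSystem (L t) m (orthoMonic (L t) m) (orthoDual (L t) m) (orthoKernel (L t) m) :=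
  isOrthogonalSystem (h.pos t ht) m

/-- The evolution in `t` of a polynomial determined by fixed values of `L t (F t * g)`. -/
lemma evolution (h : IsJacobiFamily α β γ L L₀ L₁ Lt) (ht : t ∈ Ioo (0 : ℝ) 1)
    {F : ℝ → ℝ[X]} {F' : ℝ[X]} {n : ℕ} (hF : ∀ s, (F s).degree < (n : WithBot ℕ))
    (hF' : F'.degree < ((m + 1 : ℕ) : WithBot ℕ)) (hmn : m + 1 ≤ n)
    (hc : ∀ k, HasDerivAt (fun s => (F s).coeff k) (F'.coeff k) t)
    (horth : ∀ g : ℝ[X], g.degree < (m : WithBot ℕ) → L t (F t * g) = 0)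
    (hconst : ∀ g : ℝ[X], g.degree < ((m + 1 : ℕ) : WithBot ℕ) →
      ∃ c : ℝ, ∀ s ∈ Ioo (0 : ℝ) 1, L s (F s * g) = c) :
    F' = (γ * Lt t (F t)) • orthoKernel (L t) m t := by
  have hs := h.system ht m
  rw [← sub_eq_zero]
  refine hs.eq_zero _ ?_ fun g hg => ?_
  · exact (degree_sub_le _ _).trans_lt
      (max_lt hF' ((degree_smul_le _ _).trans_lt (hs.degree_K t)))
  · have h1 := hasDerivAt_apply_polynomial (Λ := fun s => (L s).comp (LinearMap.mulRight ℝ g))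
      (Λ' := (-γ) • (Lt t).comp (LinearMap.mulRight ℝ g))
      (fun p => h.hasDerivAt t ht (p * g)) hF
      (hF'.trans_le (by exact_mod_cast hmn)) hc
    obtain ⟨c, hcg⟩ := hconst g hg
    -- Differentiating the constant `L s (F s * g)` gives `L (F' g) = γ Lt (F g)`, and orthogonality
    -- reduces the right side to `γ g(t) Lt F`.
    have h2 : HasDerivAt (fun s => (L s).comp (LinearMap.mulRight ℝ g) (F s)) 0 t := by
      refine (hasDerivAt_const t c).congr_of_eventuallyEq ?_
      filter_upwards [Ioo_mem_nhds ht.1 ht.2] with s hs'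
      exact hcg s hs'
    have h3 := h1.unique h2
    simp only [LinearMap.smul_apply, LinearMap.comp_apply, LinearMap.mulRight_apply,
      smul_eq_mul] at h3
    rw [(h.divided_self t ht).apply_mul, horth _ (degree_divByMonic_X_sub_C_lt t hg)] at h3
    rw [sub_mul, smul_mul_assoc, map_sub, map_smul, hs.apply_K t g hg, smul_eq_mul]
    linear_combination h3

lemma hankelMatrix_det_ne_zero (h : IsJacobiFamily α β γ L L₀ L₁ Lt) (ht : t ∈ Ioo (0 : ℝ) 1)
    (n : ℕ) : (hankelMatrix (L t) n).det ≠ 0 := (hankelMatrix_det_pos (h.pos t ht)).ne'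

lemma degree_orthoMonic_lt (L : ℝ[X] →ₗ[ℝ] ℝ) (m : ℕ) :
    (orthoMonic L m).degree < ((m + 2 : ℕ) : WithBot ℕ) := by
  unfold orthoMonic
  refine (degree_sub_le _ _).trans_lt (max_lt ?_ ((degree_hankelRep_lt _).trans ?_))
  · rw [degree_X_pow]; exact_mod_cast Nat.lt_succ_self _
  · exact_mod_cast Nat.lt_succ_self _

/-- Differentiability comes from the explicit Hankel solution; `evolution` then identifies the
derivative. -/
lemma hasDerivAt_coeff_orthoMonic (h : IsJacobiFamily α β γ L L₀ L₁ Lt)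
    (ht : t ∈ Ioo (0 : ℝ) 1) (m k : ℕ) :
    HasDerivAt (fun s => (orthoMonic (L s) m).coeff k)
      (((γ * Lt t (orthoMonic (L t) m)) • orthoKernel (L t) m t).coeff k) t := by
  obtain ⟨F', hdeg, hF'⟩ := exists_hankelRep_hasDerivAt (n := m + 1) (L := L)
    (u := fun s k => L s (X ^ (m + 1 + (k : ℕ))))
    (fun p => (h.hasDerivAt t ht p).differentiableAt) (h.hankelMatrix_det_ne_zero ht _)
    fun k => (h.hasDerivAt t ht _).differentiableAt
  have hc : ∀ k, HasDerivAt (fun s => (orthoMonic (L s) m).coeff k) ((-F').coeff k) t := fun k => by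
    simp only [orthoMonic, coeff_sub, coeff_neg]
    exact (hF' k).const_sub _
  rw [← h.evolution ht (n := m + 2) (F := fun s => orthoMonic (L s) m) (F' := -F')
    (fun s => degree_orthoMonic_lt _ m) (by rwa [degree_neg]) (by omega) hc
    (fun g hg => (h.system ht m).apply_P g (hg.trans (by exact_mod_cast Nat.lt_succ_self m)))
    fun g hg => ⟨0, fun s hs => (h.system hs m).apply_P g hg⟩]
  exact hc k

lemma hasDerivAt_coeff_orthoDual (h : IsJacobiFamily α β γ L L₀ L₁ Lt)
    (ht : t ∈ Ioo (0 : ℝ) 1) (m k : ℕ) :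
    HasDerivAt (fun s => (orthoDual (L s) m).coeff k)
      (((γ * Lt t (orthoDual (L t) m)) • orthoKernel (L t) m t).coeff k) t := by
  obtain ⟨F', hdeg, hF'⟩ := exists_hankelRep_hasDerivAt (n := m + 1) (L := L)
    (u := fun s => Pi.single (Fin.last m) 1)
    (fun p => (h.hasDerivAt t ht p).differentiableAt) (h.hankelMatrix_det_ne_zero ht _)
    fun k => differentiableAt_const _
  rw [← h.evolution ht (F := fun s => orthoDual (L s) m) (fun s => degree_hankelRep_lt _)
    hdeg le_rfl hF' (fun g hg => (h.system ht m).apply_R_of_degree_lt hg)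
    fun g hg => ⟨_, fun s hs => (h.system hs m).apply_R g hg⟩]
  exact hF' k

/-- The derivative in `t` of the value at `c` of a polynomial `F` with the evolution of the
orthogonal polynomials, and of the functional `F ↦ L t (F / (x - c))` at `F`. -/
lemma hasDerivAt_eval_and_apply {Lc : ℝ → ℝ[X] →ₗ[ℝ] ℝ} {c κ : ℝ} {F : ℝ → ℝ[X]} {F' : ℝ[X]} {n : ℕ}
    (hLc : ∀ f : ℝ[X], HasDerivAt (fun s => Lc s f) (-γ / (t - c) * (Lt t f - Lc t f)) t)
    (hF : ∀ s, (F s).degree < (n : WithBot ℕ)) (hF' : (κ • F').degree < (n : WithBot ℕ))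
    (hc : ∀ k, HasDerivAt (fun s => (F s).coeff k) ((κ • F').coeff k) t) :
    HasDerivAt (fun s => (F s).eval c) (κ * F'.eval c) t ∧
      HasDerivAt (fun s => Lc s (F s))
        (-γ / (t - c) * (Lt t (F t) - Lc t (F t)) + κ * Lc t F') t := by
  constructor
  · have h1 := hasDerivAt_apply_polynomial (Λ := fun _ => leval c) (Λ' := 0)
      (fun p => hasDerivAt_const _ _) hF hF' hc
    simpa using h1
  · have h1 := hasDerivAt_apply_polynomial (Λ := Lc) (Λ' := (-γ / (t - c)) • (Lt t - Lc t))
      hLc hF hF' hc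
    simpa using h1

/-- The Schlesinger equations for the residue at `c`, written with the entries `x`, `y`, `z` of
the residue matrix and those of the residue matrix at `t`. -/
lemma schlesinger (h : IsJacobiFamily α β γ L L₀ L₁ Lt) (ht : t ∈ Ioo (0 : ℝ) 1) (m : ℕ)
    {Lc : ℝ → ℝ[X] →ₗ[ℝ] ℝ} {c : ℝ} (hct : t ≠ c) (hdiv : IsDivided (L t) (Lc t) c)
    (hLc : ∀ f : ℝ[X], HasDerivAt (fun s => Lc s f) (-γ / (t - c) * (Lt t f - Lc t f)) t)
    {x y z : ℝ → ℝ} {X' Y Z : ℝ}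
    (hx : x = fun s => (orthoDual (L s) m).eval c * Lc s (orthoMonic (L s) m))
    (hy : y = fun s => (orthoMonic (L s) m).eval c * Lc s (orthoMonic (L s) m))
    (hz : z = fun s => (orthoDual (L s) m).eval c * Lc s (orthoDual (L s) m))
    (hX : X' = γ * ((orthoDual (L t) m).eval t * Lt t (orthoMonic (L t) m)))
    (hY : Y = γ * ((orthoMonic (L t) m).eval t * Lt t (orthoMonic (L t) m)))
    (hZ : Z = γ * ((orthoDual (L t) m).eval t * Lt t (orthoDual (L t) m))) :
    HasDerivAt x ((z t * Y - y t * Z) / (t - c)) t ∧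
    HasDerivAt y (((2 * x t - 1) * Y - (2 * X' - γ) * y t) / (t - c)) t ∧
    HasDerivAt z ((z t * (2 * X' - γ) - Z * (2 * x t - 1)) / (t - c)) t := by
  have hs := h.system ht m
  have hdK : ∀ κ : ℝ, (κ • orthoKernel (L t) m t).degree < ((m + 1 : ℕ) : WithBot ℕ) := fun κ =>
    (degree_smul_le _ _).trans_lt (hs.degree_K t)
  obtain ⟨hp, hP⟩ := hasDerivAt_eval_and_apply hLc (fun s => degree_orthoMonic_lt (L s) m)
    ((hdK _).trans (by exact_mod_cast Nat.lt_succ_self _)) (h.hasDerivAt_coeff_orthoMonic ht m)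
  obtain ⟨hq, hQ⟩ := hasDerivAt_eval_and_apply (F := fun s => orthoDual (L s) m) hLc (fun s => degree_hankelRep_lt _)
    (hdK _) (h.hasDerivAt_coeff_orthoDual ht m)
  have e1 := hs.sub_mul_eval_K t c
  have e2 := hs.casoratian hdiv t
  have e3 := hs.casoratian_self hdiv
  have e4 := hs.casoratian_self (h.divided_self t ht)
  have htc : t - c ≠ 0 := sub_ne_zero.mpr hct
  subst hx hy hz hX hY hZ
  -- Christoffel–Darboux and the Casoratian eliminate the kernel, leaving algebra in eight numbers
  -- subject to `e3` and `e4`.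
  have e1' : (orthoKernel (L t) m t).eval c = ((orthoDual (L t) m).eval t * (orthoMonic (L t) m).eval c
      - (orthoMonic (L t) m).eval t * (orthoDual (L t) m).eval c) / (c - t) := by
    rw [eq_div_iff (sub_ne_zero.mpr hct.symm), ← e1]; ring
  have e2' : Lc t (orthoKernel (L t) m t) = ((orthoDual (L t) m).eval t * Lc t (orthoMonic (L t) m)
      - (orthoMonic (L t) m).eval t * Lc t (orthoDual (L t) m) - 1) / (c - t) := by
    rw [eq_div_iff (sub_ne_zero.mpr hct.symm), e2]; ring
  refine ⟨(hq.mul hP).congr_deriv ?_, (hp.mul hP).congr_deriv ?_, (hq.mul hQ).congr_deriv ?_⟩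
  all_goals
    beta_reduce
    rw [e1', e2', ← neg_sub t c]
    generalize (orthoMonic (L t) m).eval c = pc at *
    generalize (orthoDual (L t) m).eval c = qc at *
    generalize (orthoMonic (L t) m).eval t = pt at *
    generalize (orthoDual (L t) m).eval t = qt at *
    generalize Lc t (orthoMonic (L t) m) = Pc at *
    generalize Lc t (orthoDual (L t) m) = Qc at *
    generalize Lt t (orthoMonic (L t) m) = Pt at *
    generalize Lt t (orthoDual (L t) m) = Qt at *
    field_simp
  · linear_combination (-γ * qc * Pc) * e4
  · linear_combination (-γ * Pt * pt) * e3
  · linear_combination (γ * Qt * qt) * e3 - 2 * γ * qc * Qc * e4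

end IsJacobiFamily

end DegenerateJacobi
end

/-! ### Elimination: from the Schlesinger equations to the second-order equation. -/

noncomputable section

namespace DegenerateJacobi

open Set Filter Topology Polynomial Matrix

/-- The second order equation in terms of the entries of the residue matrices. -/
theorem ode_of_residues {α β γ n t x0 y0 z0 x1 y1 z1 X Y Z h h1 h2 : ℝ}
  (hX : X = -n - α*x0-β*x1) (hY : Y = -α*y0-β*y1) (hZ : Z = -α*z0-β*z1)
  (e0 : y0*z0 = x0*(x0-1)) (e1 : y1*z1=x1*(x1-1)) (et : Y*Z = X*(X-γ))
  (hh : h = (t-1)*(α*((X-γ)*x0-Y*z0-Z*y0+X*(x0-1))) + t*(β*((X-γ)*x1-Y*z1-Z*y1+X*(x1-1))))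
  (hh1 : h1 = α*((X-γ)*x0-Y*z0-Z*y0+X*(x0-1)) + β*((X-γ)*x1-Y*z1-Z*y1+X*(x1-1)))
  (hh2 : t*(t-1)*h2 = (2*n+α+β+γ)*(α*β*(z0*y1-y0*z1))) :
  odeLhs α β γ n t h h1 h2 = 0 := by
  -- The symmetric mixed product; expanding `Y Z = X (X - γ)` makes it a polynomial in `x0`, `x1`.
  obtain ⟨g, hg⟩ : ∃ g, g = α*β*(y0*z1+z0*y1) := ⟨_, rfl⟩
  have hg' : g = X*(X-γ) - α^2*(x0*(x0-1)) - β^2*(x1*(x1-1)) := by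
    rw [← et, ← e0, ← e1, hg, hY, hZ]; ring
  have hU0 : α*((X-γ)*x0-Y*z0-Z*y0+X*(x0-1)) = α*((X-γ)*x0+X*(x0-1)) + 2*α^2*(x0*(x0-1)) + g := by
    rw [hg, ← e0, hY, hZ]; ring
  have hU1 : β*((X-γ)*x1-Y*z1-Z*y1+X*(x1-1)) = β*((X-γ)*x1+X*(x1-1)) + 2*β^2*(x1*(x1-1)) + g := by
    rw [hg, ← e1, hY, hZ]; ring
  -- The square of the antisymmetric product is that of the symmetric one minus `4 (y0 z0) (y1 z1)`,
  -- so only `x0`, `x1` remain.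
  have hW : t^2*(t-1)^2*h2^2 = (2*n+α+β+γ)^2*(g^2 - 4*α^2*β^2*(x0*(x0-1))*(x1*(x1-1))) := by
    rw [← e0, ← e1, hg]
    calc _ = (t*(t-1)*h2)^2 := by ring
      _ = _ := by rw [hh2]; ring
  rw [hU0, hU1] at hh hh1
  rw [odeLhs, hW, hh, hh1, hg', hX]
  ring

/-- Solutions of the Schlesinger equations give solutions of the second order equation. -/
theorem ode_of_schlesinger {α β γ n : ℝ} {x₀ y₀ z₀ x₁ y₁ z₁ X Y Z h : ℝ → ℝ}
    (hX : ∀ t, X t = -n - α * x₀ t - β * x₁ t) (hY : ∀ t, Y t = -α * y₀ t - β * y₁ t)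
    (hZ : ∀ t, Z t = -α * z₀ t - β * z₁ t)
    (e₀ : ∀ t ∈ Ioo (0 : ℝ) 1, y₀ t * z₀ t = x₀ t * (x₀ t - 1))
    (e₁ : ∀ t ∈ Ioo (0 : ℝ) 1, y₁ t * z₁ t = x₁ t * (x₁ t - 1))
    (e : ∀ t ∈ Ioo (0 : ℝ) 1, Y t * Z t = X t * (X t - γ))
    (hx₀ : ∀ t ∈ Ioo (0 : ℝ) 1, HasDerivAt x₀ ((z₀ t * Y t - y₀ t * Z t) / (t - 0)) t)
    (hy₀ : ∀ t ∈ Ioo (0 : ℝ) 1,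
      HasDerivAt y₀ (((2 * x₀ t - 1) * Y t - (2 * X t - γ) * y₀ t) / (t - 0)) t)
    (hz₀ : ∀ t ∈ Ioo (0 : ℝ) 1,
      HasDerivAt z₀ ((z₀ t * (2 * X t - γ) - Z t * (2 * x₀ t - 1)) / (t - 0)) t)
    (hx₁ : ∀ t ∈ Ioo (0 : ℝ) 1, HasDerivAt x₁ ((z₁ t * Y t - y₁ t * Z t) / (t - 1)) t)
    (hy₁ : ∀ t ∈ Ioo (0 : ℝ) 1,
      HasDerivAt y₁ (((2 * x₁ t - 1) * Y t - (2 * X t - γ) * y₁ t) / (t - 1)) t)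
    (hz₁ : ∀ t ∈ Ioo (0 : ℝ) 1,
      HasDerivAt z₁ ((z₁ t * (2 * X t - γ) - Z t * (2 * x₁ t - 1)) / (t - 1)) t)
    (hh : ∀ t ∈ Ioo (0 : ℝ) 1, h t =
      (t - 1) * (α * ((X t - γ) * x₀ t - Y t * z₀ t - Z t * y₀ t + X t * (x₀ t - 1)))
      + t * (β * ((X t - γ) * x₁ t - Y t * z₁ t - Z t * y₁ t + X t * (x₁ t - 1))))
    {t : ℝ} (ht : t ∈ Ioo (0 : ℝ) 1) :
    DifferentiableAt ℝ h t ∧ DifferentiableAt ℝ (deriv h) t ∧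
      odeLhs α β γ n t (h t) (deriv h t) (deriv (deriv h) t) = 0 := by
  have dX : ∀ t ∈ Ioo (0 : ℝ) 1, HasDerivAt X
      (-α * ((z₀ t * Y t - y₀ t * Z t) / (t - 0)) - β * ((z₁ t * Y t - y₁ t * Z t) / (t - 1))) t :=
    fun t ht => by
      rw [funext hX]
      exact ((((hx₀ t ht).const_mul α).const_sub (-n)).sub ((hx₁ t ht).const_mul β)).congr_deriv
        (by ring)
  have dY : ∀ t ∈ Ioo (0 : ℝ) 1, HasDerivAt Y
      (-α * (((2 * x₀ t - 1) * Y t - (2 * X t - γ) * y₀ t) / (t - 0))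
        - β * (((2 * x₁ t - 1) * Y t - (2 * X t - γ) * y₁ t) / (t - 1))) t := fun t ht => by
      have := ((hy₀ t ht).const_mul (-α)).sub ((hy₁ t ht).const_mul β)
      exact this.congr_of_eventuallyEq (Eventually.of_forall hY)
  have dZ : ∀ t ∈ Ioo (0 : ℝ) 1, HasDerivAt Z
      (-α * ((z₀ t * (2 * X t - γ) - Z t * (2 * x₀ t - 1)) / (t - 0))
        - β * ((z₁ t * (2 * X t - γ) - Z t * (2 * x₁ t - 1)) / (t - 1))) t := fun t ht => by
      have := ((hz₀ t ht).const_mul (-α)).sub ((hz₁ t ht).const_mul β)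
      exact this.congr_of_eventuallyEq (Eventually.of_forall hZ)
  -- `u₀`, `u₁` are, up to constants, traces of products of residues, and `2n + α + β + γ` is the
  -- eigenvalue gap of the residue at infinity. Since `u₀' = W/(t-1)` and `u₁' = -W/t`, the extra
  -- terms cancel in `h' = u₀ + u₁`.
  obtain ⟨W, hW⟩ : ∃ W : ℝ → ℝ, W = fun t => (2 * n + α + β + γ) *
    (α * β * (z₀ t * y₁ t - y₀ t * z₁ t)) := ⟨_, rfl⟩
  obtain ⟨u₀, hu₀⟩ : ∃ u : ℝ → ℝ, u = fun t =>
    α * ((X t - γ) * x₀ t - Y t * z₀ t - Z t * y₀ t + X t * (x₀ t - 1)) := ⟨_, rfl⟩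
  obtain ⟨u₁, hu₁⟩ : ∃ u : ℝ → ℝ, u = fun t =>
    β * ((X t - γ) * x₁ t - Y t * z₁ t - Z t * y₁ t + X t * (x₁ t - 1)) := ⟨_, rfl⟩
  have du₀ : ∀ t ∈ Ioo (0 : ℝ) 1, HasDerivAt u₀ (W t / (t - 1)) t := fun t ht => by
    have h1 : t - 1 ≠ 0 := by linarith [ht.2]
    have h0 : t ≠ 0 := ht.1.ne'
    rw [hu₀, hW]
    refine (((((((dX t ht).sub_const γ).mul (hx₀ t ht)).sub ((dY t ht).mul (hz₀ t ht))).sub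
      ((dZ t ht).mul (hy₀ t ht))).add ((dX t ht).mul ((hx₀ t ht).sub_const 1))).const_mul
      α).congr_deriv ?_
    rw [hX, hY, hZ, sub_zero]
    field_simp
    ring
  have du₁ : ∀ t ∈ Ioo (0 : ℝ) 1, HasDerivAt u₁ (-W t / t) t := fun t ht => by
    have h1 : t - 1 ≠ 0 := by linarith [ht.2]
    have h0 : t ≠ 0 := ht.1.ne'
    rw [hu₁, hW]
    refine (((((((dX t ht).sub_const γ).mul (hx₁ t ht)).sub ((dY t ht).mul (hz₁ t ht))).sub
      ((dZ t ht).mul (hy₁ t ht))).add ((dX t ht).mul ((hx₁ t ht).sub_const 1))).const_mul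
      β).congr_deriv ?_
    rw [hX, hY, hZ, sub_zero]
    field_simp
    ring
  have dh : ∀ t ∈ Ioo (0 : ℝ) 1, HasDerivAt h (u₀ t + u₁ t) t := fun t ht => by
    have h1 : t - 1 ≠ 0 := by linarith [ht.2]
    have h0 : t ≠ 0 := ht.1.ne'
    have key := (((hasDerivAt_id t).sub_const 1).mul (du₀ t ht)).add
      ((hasDerivAt_id t).mul (du₁ t ht))
    refine (key.congr_of_eventuallyEq ?_).congr_deriv ?_
    · filter_upwards [Ioo_mem_nhds ht.1 ht.2] with s hs
      rw [hh s hs, hu₀, hu₁]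
      rfl
    · simp only [id]
      field_simp
      ring
  have ddh : HasDerivAt (deriv h) (W t / (t - 1) + -W t / t) t := by
    refine ((du₀ t ht).add (du₁ t ht)).congr_of_eventuallyEq ?_
    filter_upwards [Ioo_mem_nhds ht.1 ht.2] with s hs
    exact (dh s hs).deriv
  refine ⟨(dh t ht).differentiableAt, ddh.differentiableAt, ?_⟩
  refine ode_of_residues (hX t) (hY t) (hZ t) (e₀ t ht) (e₁ t ht) (e t ht) (hh t ht) ?_ ?_
  · rw [(dh t ht).deriv, hu₀, hu₁]
  · have h1 : t - 1 ≠ 0 := by linarith [ht.2]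
    have h0 : t ≠ 0 := ht.1.ne'
    rw [ddh.deriv, hW]
    field_simp
    ring

end DegenerateJacobi
end

/-! ### The functionals of the actual weight. -/

noncomputable section

namespace DegenerateJacobi

open MeasureTheory Set Filter Topology Polynomial Matrix

/-- The linear functional on polynomials with the given moments. -/
def ofMoments (μ : ℕ → ℝ) : ℝ[X] →ₗ[ℝ] ℝ := Polynomial.lsum fun k => μ k • LinearMap.id

lemma ofMoments_X_pow (μ : ℕ → ℝ) (k : ℕ) : ofMoments μ (X ^ k) = μ k := by
  rw [ofMoments, lsum_apply, ← monomial_one_right_eq_X_pow, sum_monomial_index _ _ (by simp)]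
  simp

lemma ofMoments_apply (μ : ℕ → ℝ) (f : ℝ[X]) :
    ofMoments μ f = ∑ k ∈ f.support, μ k * f.coeff k := by
  simp [ofMoments, lsum_apply, sum_def]

lemma linearMap_ext_X_pow {Φ Ψ : ℝ[X] →ₗ[ℝ] ℝ} (h : ∀ k : ℕ, Φ (X ^ k) = Ψ (X ^ k)) : Φ = Ψ := by
  refine lhom_ext' fun k => LinearMap.ext_ring ?_
  simpa [monomial_one_right_eq_X_pow] using h k

lemma isDivided_of_X_pow {L Λ : ℝ[X] →ₗ[ℝ] ℝ} {s : ℝ}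
    (h : ∀ k : ℕ, Λ (X ^ (k + 1)) - s * Λ (X ^ k) = L (X ^ k)) : IsDivided L Λ s := by
  have : Λ.comp (LinearMap.mulLeft ℝ (X - C s)) = L := linearMap_ext_X_pow fun k => by
    rw [LinearMap.comp_apply, LinearMap.mulLeft_apply, sub_mul, map_sub, ← pow_succ',
      ← smul_eq_C_mul, map_smul, smul_eq_mul, h]
  exact fun f => LinearMap.congr_fun this f

lemma hasDerivAt_ofMoments {μ : ℝ → ℕ → ℝ} {Λ : ℝ[X] →ₗ[ℝ] ℝ} {t : ℝ}
    (h : ∀ k, HasDerivAt (fun s => μ s k) (Λ (X ^ k)) t) (f : ℝ[X]) :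
    HasDerivAt (fun s => ofMoments (μ s) f) (Λ f) t := by
  have hΛ : Λ = ofMoments fun k => Λ (X ^ k) :=
    linearMap_ext_X_pow fun k => (ofMoments_X_pow (fun k => Λ (X ^ k)) k).symm
  rw [hΛ]
  simp only [ofMoments_apply]
  exact HasDerivAt.fun_sum fun k _ => (h k).mul_const _

section Concrete

variable {α β γ A B t : ℝ}

lemma jumpIntegral_sub (hγ : 0 < γ) {a b : ℝ} (ha : -1 < a) (hb : -1 < b) (t : ℝ) :
    jumpIntegral γ A B a b t - jumpIntegral γ A B (a + 1) b t = jumpIntegral γ A B a (b + 1) t := by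
  rw [jumpIntegral, jumpIntegral, jumpIntegral, ← intervalIntegral.integral_sub
    (intervalIntegrable_mul_jump hγ ha hb t)
    (intervalIntegrable_mul_jump hγ (by linarith) hb t)]
  refine intervalIntegral.integral_congr fun x hx => ?_
  rw [uIcc_of_le zero_le_one] at hx
  rw [Real.rpow_add_one' hx.1 (by linarith), Real.rpow_add_one' (sub_nonneg.mpr hx.2) (by linarith)]
  ring

lemma continuous_mul_jump (hα : 0 < α) (hβ : 0 < β) (hγ : 0 < γ) (t : ℝ) :
    Continuous fun x : ℝ => x ^ α * (1 - x) ^ β * jump γ A B (x - t) :=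
  ((continuous_id.rpow_const fun _ => Or.inr hα.le).mul
    ((continuous_const.sub continuous_id).rpow_const fun _ => Or.inr hβ.le)).mul
    ((continuous_jump hγ).comp (by fun_prop : Continuous fun x : ℝ => x - t))

/-- Integration of polynomials against the weight, as a linear functional. -/
def weightFunctional (α β γ A B t : ℝ) : ℝ[X] →ₗ[ℝ] ℝ :=
  ofMoments fun k => jumpIntegral γ A B (α + k) β t

lemma integral_pow_mul (hα : 0 < α) (k : ℕ) :
    ∫ x in (0 : ℝ)..1, x ^ k * (x ^ α * (1 - x) ^ β * jump γ A B (x - t))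
      = jumpIntegral γ A B (α + k) β t := by
  refine intervalIntegral.integral_congr fun x hx => ?_
  rw [uIcc_of_le zero_le_one] at hx
  rw [Real.rpow_add' hx.1 (by positivity), Real.rpow_natCast]
  ring

lemma moment_eq (hα : 0 < α) (k : ℕ) :
    moment α β γ A B k t = jumpIntegral γ A B (α + k) β t := by
  rw [← integral_pow_mul hα, moment]
  refine intervalIntegral.integral_congr fun x _ => ?_
  simp only [weight, jump]
  ring

lemma hankelDet_eq (hα : 0 < α) (n : ℕ) (t : ℝ) :
    hankelDet α β γ A B n t = (hankelMatrix (weightFunctional α β γ A B t) n).det := by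
  unfold hankelDet hankelMatrix weightFunctional
  congr 2
  ext i j
  rw [ofMoments_X_pow, moment_eq hα]

lemma weightFunctional_apply (hα : 0 < α) (hβ : 0 < β) (hγ : 0 < γ) (f : ℝ[X]) :
    weightFunctional α β γ A B t f
      = ∫ x in (0 : ℝ)..1, f.eval x * (x ^ α * (1 - x) ^ β * jump γ A B (x - t)) := by
  rw [weightFunctional, ofMoments_apply]
  simp only [← integral_pow_mul hα, eval_eq_sum, sum_def, Finset.sum_mul]
  rw [intervalIntegral.integral_finsetSum]
  · refine Finset.sum_congr rfl fun k _ => ?_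
    rw [mul_comm, ← intervalIntegral.integral_const_mul]
    simp only [mul_assoc]
  · intro k _
    have := continuous_mul_jump (A := A) (B := B) hα hβ hγ t
    exact Continuous.intervalIntegrable (by fun_prop) _ _

lemma jump_nonneg (hA : 0 ≤ A) (hAB : 0 ≤ A + B) (u : ℝ) : 0 ≤ jump γ A B u := by
  refine mul_nonneg (Real.rpow_nonneg (abs_nonneg u) _) ?_
  unfold heaviside
  split_ifs <;> simpa

/-- If `A = 0` the weight lives to the right of `t`; otherwise it is positive to the left. -/
lemma exists_Ioo_jump_pos (hA : 0 ≤ A) (hAB : 0 ≤ A + B) (hne : ¬ (A = 0 ∧ B = 0))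
    (ht0 : 0 < t) (ht1 : t < 1) :
    ∃ p q : ℝ, 0 ≤ p ∧ p < q ∧ q ≤ 1 ∧ ∀ x ∈ Ioo p q, 0 < jump γ A B (x - t) := by
  rcases hA.eq_or_lt with rfl | hA
  · have hB : 0 < B := lt_of_le_of_ne (by linarith) fun h => hne ⟨rfl, h.symm⟩
    refine ⟨t, 1, ht0.le, ht1, le_rfl, fun x hx => ?_⟩
    have h1 : 0 < x - t := sub_pos.mpr hx.1
    have h2 : 0 < |x - t| := abs_pos.mpr h1.ne'
    rw [jump, heaviside, if_pos h1, zero_add, mul_one]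
    exact mul_pos (Real.rpow_pos_of_pos h2 γ) hB
  · refine ⟨0, t, le_rfl, ht0, ht1.le, fun x hx => ?_⟩
    have h1 : x - t < 0 := sub_neg.mpr hx.2
    have h2 : 0 < |x - t| := abs_pos.mpr h1.ne
    rw [jump, heaviside, if_neg (not_lt.mpr h1.le), mul_zero, add_zero]
    exact mul_pos (Real.rpow_pos_of_pos h2 γ) hA

lemma weightFunctional_pos (hα : 0 < α) (hβ : 0 < β) (hγ : 0 < γ) (hA : 0 ≤ A)
    (hAB : 0 ≤ A + B) (hne : ¬ (A = 0 ∧ B = 0)) (ht0 : 0 < t) (ht1 : t < 1) {f : ℝ[X]}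
    (hf : f ≠ 0) : 0 < weightFunctional α β γ A B t (f * f) := by
  rw [weightFunctional_apply hα hβ hγ]
  have hc := continuous_mul_jump (A := A) (B := B) hα hβ hγ t
  have hi : IntervalIntegrable (fun x => (f * f).eval x *
      (x ^ α * (1 - x) ^ β * jump γ A B (x - t))) volume 0 1 :=
    Continuous.intervalIntegrable (by fun_prop) _ _
  rw [intervalIntegral.integral_pos_iff_support_of_nonneg_ae' ?_ hi]
  · refine ⟨zero_lt_one, ?_⟩
    obtain ⟨p, q, hp, hpq, hq, hpos⟩ := exists_Ioo_jump_pos (γ := γ) hA hAB hne ht0 ht1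
    have hfin : volume (f.roots.toFinset : Set ℝ) = 0 :=
      (Finset.finite_toSet _).measure_zero _
    refine lt_of_lt_of_le ?_ (measure_mono (s := Ioo p q \ (f.roots.toFinset : Set ℝ)) ?_)
    · rw [measure_sdiff_null hfin, Real.volume_Ioo]
      simpa using hpq
    · rintro x ⟨hx, hxr⟩
      have hx0 : 0 < x := hp.trans_lt hx.1
      have hx1 : x < 1 := hx.2.trans_le hq
      refine ⟨?_, hx0, hx1.le⟩
      have h1 : f.eval x ≠ 0 := fun h => hxr (by simp [hf, h])
      have h2 := Real.rpow_pos_of_pos hx0 α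
      have h3 := Real.rpow_pos_of_pos (sub_pos.mpr hx1) β
      rw [Function.mem_support, eval_mul]
      exact mul_ne_zero (mul_ne_zero h1 h1) (mul_pos (mul_pos h2 h3) (hpos x hx)).ne'
  · rw [uIoc_of_le zero_le_one]
    refine (ae_restrict_iff' measurableSet_Ioc).mpr (Eventually.of_forall fun x hx => ?_)
    simp only [Pi.zero_apply, eval_mul]
    exact mul_nonneg (mul_self_nonneg _) (mul_nonneg (mul_nonneg (Real.rpow_nonneg hx.1.le _)
      (Real.rpow_nonneg (sub_nonneg.mpr hx.2) _)) (jump_nonneg hA hAB _))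

/-- Division by `x` or `x - 1` lowers an endpoint exponent by one; the minus sign comes from `x - 1
= -(1 - x)`. -/
lemma isJacobiFamily (hα : 0 < α) (hβ : 0 < β) (hγ : 0 < γ) (hA : 0 ≤ A)
    (hAB : 0 ≤ A + B) (hne : ¬ (A = 0 ∧ B = 0)) :
    IsJacobiFamily α β γ (weightFunctional α β γ A B)
      (fun t => ofMoments fun k => jumpIntegral γ A B (α - 1 + k) β t)
      (fun t => ofMoments fun k => -jumpIntegral γ A B (α + k) (β - 1) t)
      (fun t => ofMoments fun k => jumpDivIntegral γ A B (α + k) β t) := by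
  have ha : ∀ k : ℕ, 0 < α + k := fun k => by positivity
  have ha' : ∀ k : ℕ, -1 < α - 1 + k := fun k => by linarith [ha k]
  have hb : -1 < β - 1 := by linarith
  refine ⟨fun t ht f hf => weightFunctional_pos hα hβ hγ hA hAB hne ht.1 ht.2 hf,
    fun t ht => isDivided_of_X_pow fun k => ?_, fun t ht => isDivided_of_X_pow fun k => ?_,
    fun t ht => isDivided_of_X_pow fun k => ?_, fun t ht f => ?_,
    fun t ht f => ?_, fun t ht f => ?_, fun t ht f => ?_⟩
  · simp only [weightFunctional, ofMoments_X_pow, zero_mul, sub_zero]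
    push_cast
    congr 1
    ring
  · have h := jumpIntegral_sub (A := A) (B := B) hγ (by linarith [ha k] : -1 < α + k) hb t
    simp only [weightFunctional, ofMoments_X_pow]
    rw [sub_add_cancel, add_assoc] at h
    push_cast
    linear_combination h
  · have h := mul_jumpDivIntegral (A := A) (B := B) hγ (by linarith [ha k] : -1 < α + k)
      (by linarith : -1 < β) ht.1 ht.2
    simp only [weightFunctional, ofMoments_X_pow]
    rw [add_assoc] at h
    push_cast
    linear_combination -h
  · have h : (weightFunctional α β γ A B t).comp derivative
        + α • (ofMoments fun k => jumpIntegral γ A B (α - 1 + k) β t)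
        + β • (ofMoments fun k => -jumpIntegral γ A B (α + k) (β - 1) t)
        + γ • (ofMoments fun k => jumpDivIntegral γ A B (α + k) β t) = 0 := by
      refine linearMap_ext_X_pow fun k => ?_
      have h := jump_integration_by_parts (A := A) (B := B) hγ (ha k) hβ ht.1 ht.2
      simp only [LinearMap.add_apply, LinearMap.comp_apply, LinearMap.smul_apply, ofMoments_X_pow,
        derivative_X_pow, ← smul_eq_C_mul, map_smul, smul_eq_mul, LinearMap.zero_apply,
        weightFunctional]
      rw [add_sub_right_comm] at h
      -- The case `k = 0` is separate, since the derivative of `X ^ k` involves the truncated `k -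
      -- 1`.
      rcases k with _ | k
      · simp only [Nat.cast_zero, add_zero, zero_mul, zero_add] at h ⊢
        linear_combination h
      · simp only [Nat.add_sub_cancel]
        have e : α - 1 + ((k + 1 : ℕ) : ℝ) = α + k := by push_cast; ring
        rw [e] at h ⊢
        linear_combination h
    exact LinearMap.congr_fun h f
  · refine hasDerivAt_ofMoments (Λ := (-γ) • ofMoments fun k => jumpDivIntegral γ A B (α + k) β t)
      (fun k => ?_) f
    rw [LinearMap.smul_apply, ofMoments_X_pow]
    exact hasDerivAt_jumpIntegral hγ (by linarith [ha k]) (by linarith) ht.1 ht.2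
  · refine hasDerivAt_ofMoments (Λ := (-γ / (t - 0)) •
      ((ofMoments fun k => jumpDivIntegral γ A B (α + k) β t)
        - ofMoments fun k => jumpIntegral γ A B (α - 1 + k) β t)) (fun k => ?_) f
    rw [LinearMap.smul_apply, LinearMap.sub_apply, ofMoments_X_pow, ofMoments_X_pow]
    refine (hasDerivAt_jumpIntegral hγ (ha' k) (by linarith) ht.1 ht.2).congr_deriv ?_
    have h := mul_jumpDivIntegral (A := A) (B := B) hγ (ha' k) (by linarith : -1 < β) ht.1 ht.2
    rw [show α - 1 + (k : ℝ) + 1 = α + k by ring] at h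
    have h0 : t ≠ 0 := ht.1.ne'
    rw [sub_zero, ← h, smul_eq_mul]
    field_simp
  · refine hasDerivAt_ofMoments (Λ := (-γ / (t - 1)) •
      ((ofMoments fun k => jumpDivIntegral γ A B (α + k) β t)
        - ofMoments fun k => -jumpIntegral γ A B (α + k) (β - 1) t)) (fun k => ?_) f
    rw [LinearMap.smul_apply, LinearMap.sub_apply, ofMoments_X_pow, ofMoments_X_pow]
    refine (hasDerivAt_jumpIntegral hγ (by linarith [ha k]) hb ht.1 ht.2).neg.congr_deriv ?_
    have h := sub_one_mul_jumpDivIntegral (A := A) (B := B) hγ (by linarith [ha k] : -1 < α + k)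
      hb ht.1 ht.2
    rw [sub_add_cancel] at h
    have h0 : t - 1 ≠ 0 := by linarith [ht.2]
    rw [smul_eq_mul]
    field_simp
    linear_combination h

end Concrete

/-! ### Logarithmic derivative of the determinant and conclusion. -/

namespace IsJacobiFamily

variable {α β γ t : ℝ} {L L₀ L₁ Lt : ℝ → ℝ[X] →ₗ[ℝ] ℝ} {m : ℕ}

lemma hasDerivAt_hankelMatrix_det (h : IsJacobiFamily α β γ L L₀ L₁ Lt) (ht : t ∈ Ioo (0 : ℝ) 1)
    (m : ℕ) : HasDerivAt (fun s => (hankelMatrix (L s) (m + 1)).det)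
      ((hankelMatrix (L t) (m + 1)).det * (-γ * Lt t (orthoKernel (L t) m t))) t := by
  have hdet := h.hankelMatrix_det_ne_zero ht (m + 1)
  refine (hasDerivAt_det (M := fun s => hankelMatrix (L s) (m + 1)) (M' := (-γ) • hankelMatrix (Lt t) (m + 1))
    fun i j => h.hasDerivAt t ht _).congr_deriv ?_
  have hadj : adjugate (hankelMatrix (L t) (m + 1))
      = (hankelMatrix (L t) (m + 1)).det • (hankelMatrix (L t) (m + 1))⁻¹ := by
    rw [inv_def, smul_smul, Ring.mul_inverse_cancel _ hdet.isUnit, one_smul]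
  rw [hadj, Matrix.mul_smul, Matrix.smul_mul, trace_smul, trace_smul,
    trace_inv_mul_hankelMatrix hdet.isUnit (h.divided_self t ht), smul_eq_mul, smul_eq_mul]
  ring

/-- The logarithmic derivative of the Hankel determinant satisfies the second order equation. -/
theorem ode (h : IsJacobiFamily α β γ L L₀ L₁ Lt) (m : ℕ) {Hn : ℝ → ℝ}
    (hH : ∀ t ∈ Ioo (0 : ℝ) 1, Hn t =
      t * (t - 1) * deriv (fun s => Real.log (hankelMatrix (L s) (m + 1)).det) t)
    (ht : t ∈ Ioo (0 : ℝ) 1) :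
    DifferentiableAt ℝ Hn t ∧ DifferentiableAt ℝ (deriv Hn) t ∧
      odeLhs α β γ (m + 1) t (Hn t) (deriv Hn t) (deriv (deriv Hn) t) = 0 := by
  obtain ⟨P, hP⟩ : ∃ P : ℝ → ℝ[X], P = fun s => orthoMonic (L s) m := ⟨_, rfl⟩
  obtain ⟨R, hR⟩ : ∃ R : ℝ → ℝ[X], R = fun s => orthoDual (L s) m := ⟨_, rfl⟩
  have hs : ∀ t ∈ Ioo (0 : ℝ) 1, IsOrthogonalSystem (L t) m (P t) (R t) (orthoKernel (L t) m) :=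
    fun t ht => by rw [hP, hR]; exact h.system ht m
  have sPR := fun t ht => (hs t ht).sum_residue_PR (h.divided_zero t ht) (h.divided_one t ht)
    (h.divided_self t ht) (h.pearson t ht)
  have sPP := fun t ht => (hs t ht).sum_residue_PP (h.divided_zero t ht) (h.divided_one t ht)
    (h.divided_self t ht) (h.pearson t ht)
  have sRR := fun t ht => (hs t ht).sum_residue_RR (h.divided_zero t ht) (h.divided_one t ht)
    (h.divided_self t ht) (h.pearson t ht)
  have c₀ := fun t ht => (hs t ht).casoratian_self (h.divided_zero t ht)
  have c₁ := fun t ht => (hs t ht).casoratian_self (h.divided_one t ht)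
  have c := fun t ht => (hs t ht).casoratian_self (h.divided_self t ht)
  -- Defined from the poles `0` and `1`, so that the linear relations hold for all `s`; agreement
  -- with the residue at `t` is proved only on `(0, 1)`.
  obtain ⟨X', hX⟩ : ∃ X' : ℝ → ℝ, X' = fun s => -(m + 1 : ℝ) - α * ((R s).eval 0 * L₀ s (P s))
    - β * ((R s).eval 1 * L₁ s (P s)) := ⟨_, rfl⟩
  obtain ⟨Y, hY⟩ : ∃ Y : ℝ → ℝ, Y = fun s => -α * ((P s).eval 0 * L₀ s (P s))
    - β * ((P s).eval 1 * L₁ s (P s)) := ⟨_, rfl⟩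
  obtain ⟨Z, hZ⟩ : ∃ Z : ℝ → ℝ, Z = fun s => -α * ((R s).eval 0 * L₀ s (R s))
    - β * ((R s).eval 1 * L₁ s (R s)) := ⟨_, rfl⟩
  have eX : ∀ t ∈ Ioo (0 : ℝ) 1, X' t = γ * ((R t).eval t * Lt t (P t)) := fun t ht => by
    rw [hX]; linear_combination -sPR t ht
  have eY : ∀ t ∈ Ioo (0 : ℝ) 1, Y t = γ * ((P t).eval t * Lt t (P t)) := fun t ht => by
    rw [hY]; linear_combination -sPP t ht
  have eZ : ∀ t ∈ Ioo (0 : ℝ) 1, Z t = γ * ((R t).eval t * Lt t (R t)) := fun t ht => by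
    rw [hZ]; linear_combination -sRR t ht
  have d₀ : ∀ t ∈ Ioo (0 : ℝ) 1, _ := fun t ht => h.schlesinger ht m ht.1.ne' (h.divided_zero t ht)
    (h.hasDerivAt_zero t ht) (x := fun s => (R s).eval 0 * L₀ s (P s))
    (y := fun s => (P s).eval 0 * L₀ s (P s)) (z := fun s => (R s).eval 0 * L₀ s (R s))
    (by rw [hP, hR]) (by rw [hP]) (by rw [hR])
    ((eX t ht).trans (by rw [hP, hR])) ((eY t ht).trans (by rw [hP]))
    ((eZ t ht).trans (by rw [hR]))
  have d₁ : ∀ t ∈ Ioo (0 : ℝ) 1, _ := fun t ht => h.schlesinger ht m ht.2.ne (h.divided_one t ht)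
    (h.hasDerivAt_one t ht) (x := fun s => (R s).eval 1 * L₁ s (P s))
    (y := fun s => (P s).eval 1 * L₁ s (P s)) (z := fun s => (R s).eval 1 * L₁ s (R s))
    (by rw [hP, hR]) (by rw [hP]) (by rw [hR])
    ((eX t ht).trans (by rw [hP, hR])) ((eY t ht).trans (by rw [hP]))
    ((eZ t ht).trans (by rw [hR]))
  refine ode_of_schlesinger (X := X') (Y := Y) (Z := Z) (fun s => by rw [hX]) (fun s => by rw [hY])
    (fun s => by rw [hZ]) (fun s hs' => ?_) (fun s hs' => ?_) (fun s hs' => ?_)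
    (fun t ht => (d₀ t ht).1) (fun t ht => (d₀ t ht).2.1) (fun t ht => (d₀ t ht).2.2)
    (fun t ht => (d₁ t ht).1) (fun t ht => (d₁ t ht).2.1) (fun t ht => (d₁ t ht).2.2)
    (fun s hs' => ?_) ht
  · linear_combination (-(R s).eval 0 * L₀ s (P s)) * c₀ s hs'
  · linear_combination (-(R s).eval 1 * L₁ s (P s)) * c₁ s hs'
  · rw [eX s hs', eY s hs', eZ s hs']
    linear_combination (-γ ^ 2 * (R s).eval s * Lt s (P s)) * c s hs'
  · have hdet := h.hankelMatrix_det_ne_zero hs' (m + 1)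
    have hlog : deriv (fun s => Real.log (hankelMatrix (L s) (m + 1)).det) s
        = -γ * Lt s (orthoKernel (L s) m s) := by
      rw [((h.hasDerivAt_hankelMatrix_det hs' m).log hdet).deriv, mul_div_cancel_left₀ _ hdet]
    have key := (hs s hs').apply_K_self (h.divided_zero s hs') (h.divided_one s hs')
      (h.divided_self s hs') (h.pearson s hs') continuous_apply_orthoKernel.continuousAt
    rw [hH s hs', hlog, eX s hs', eY s hs', eZ s hs']
    linear_combination γ * key
      - (γ * (s - 1) * α * ((R s).eval s * Lt s (P s))) * c₀ s hs'
      - (γ * s * β * ((R s).eval s * Lt s (P s))) * c₁ s hs'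
      - (γ * (s - 1) * α * ((R s).eval 0 * L₀ s (P s))
        + γ * s * β * ((R s).eval 1 * L₁ s (P s))) * c s hs'

end IsJacobiFamily

end DegenerateJacobi

end

theorem mainTheorem1 (α β γ A B : ℝ) (hα : 0 < α) (hβ : 0 < β) (hγ : 0 < γ)
    (hA : 0 ≤ A) (hAB : 0 ≤ A + B) (hne : ¬ (A = 0 ∧ B = 0))
    (n : ℕ) (t : ℝ) (ht0 : 0 < t) (ht1 : t < 1) :
    0 < DegenerateJacobi.hankelDet α β γ A B n t ∧
    DifferentiableAt ℝ (DegenerateJacobi.hankelDet α β γ A B n) t ∧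
    DifferentiableAt ℝ (DegenerateJacobi.H α β γ A B n) t ∧
    DifferentiableAt ℝ (deriv (DegenerateJacobi.H α β γ A B n)) t ∧
    DegenerateJacobi.odeLhs α β γ n t
      (DegenerateJacobi.H α β γ A B n t)
      (deriv (DegenerateJacobi.H α β γ A B n) t)
      (deriv (deriv (DegenerateJacobi.H α β γ A B n)) t) = 0 := by
  have h := DegenerateJacobi.isJacobiFamily hα hβ hγ hA hAB hne
  have hD : DegenerateJacobi.hankelDet α β γ A B n = fun s =>
      (DegenerateJacobi.hankelMatrix (DegenerateJacobi.weightFunctional α β γ A B s) n).det :=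
    funext fun s => DegenerateJacobi.hankelDet_eq hα n s
  refine ⟨?_, ?_⟩
  · rw [hD]
    exact DegenerateJacobi.hankelMatrix_det_pos (h.pos t ⟨ht0, ht1⟩)
  · rcases n with _ | m
    -- For `n = 0` the determinant is `1` and `H` vanishes; every term of `odeLhs` contains `n`, `h`
    -- or a derivative.
    · have h1 : DegenerateJacobi.hankelDet α β γ A B 0 = fun _ => 1 := by
        rw [hD]
        exact funext fun s => Matrix.det_isEmpty
      have h2 : DegenerateJacobi.H α β γ A B 0 = fun _ => 0 := by
        funext s
        simp [DegenerateJacobi.H, h1]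
      rw [h1, h2]
      simp [DegenerateJacobi.odeLhs]
    · rw [Nat.cast_succ]
      refine ⟨?_, h.ode m (fun s _ => ?_) ⟨ht0, ht1⟩⟩
      · rw [hD]
        exact (h.hasDerivAt_hankelMatrix_det ⟨ht0, ht1⟩ m).differentiableAt
      · rw [DegenerateJacobi.H, hD]
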